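/- Let $(X_n)_{n\ge 1}$ be a sequence of separable real Banach spaces and let $\mathcal Z=(\sum_n\oplus X_n)_{AH}$ be its Argyros–Haydon sum, constructed as follows. *Choices.* Fix natural numbers $(m_j)_{j\ge1}$, $(n_j)_{j\ge 1}$ with $m_1\ge4$, $m_{j+1}\ge m_j^2$, $n_1\ge m_1^2$, $n_{j+1}\ge(16n_j)^{\log_2 m_{j+1}}$; a strictly increasing sequence $(N_n)$ of natural numbers; and for each $k$ a countable symmetric 1-norming subset $F_k$ of the unit ball of $X_k^*$, enumerated by a sequence, with $F_k^n$ the set of its first $n$ terms. *The sets $\Delta_n$.* One defines recursively finite, pairwise disjoint sets $\Delta_n$; an element of $\Delta_n$ has rank $n$. Put $\Gamma_n=\Delta_1\cup\dots\cup\Delta_n$, $\Gamma=\bigcup_n\Gamma_n$. Together with $\Delta_n$ one chooses $\sigma$ on $\Delta_n$ with values in $\mathbb N$, injective on each $\Delta_n$, with all values on $\Delta_{n}$ less than all values on $\Delta_{n+1}$. $\Delta_1$ has one element, which has no weight, and $\sigma=2$ there. For $0\le p<n$ let $K_{n,p}$ be the set of $\vec f=(f_{p+1},\dots,f_n)$ with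 $f_k\in F_k^n\cup\{0\}$ and $\sum\|f_k\|\le1$, and let $B_{n,p}$ be the set of $b^*=\sum_{\gamma\in\Gamma_n\setminus\Gamma_p}b_\gamma e^*_\gamma$ with $b_\gamma$ rational of denominator dividing $N_n!$ and $\sum|b_\gamma|\le1$. For $n\ge1$ the elements of $\Delta_{n+1}$ are the tuples * $(n+1,p,\vec f,0)$ with $p<n$, $\vec f\in K_{n,p}$ (weight $1$); * $(n+1,m_{2j},p,b^*)$ with $j\ge 1$, $2j\le n+1$, $p<n$, $b^*\in B_{n,p}$; * $(n+1,\eta,m_{2j},p,b^*)$ with $j\ge 1$, $2j\le n+1$, $p<n$, $\eta\in\Delta_p$, $w(\eta)=m_{2j}$, age of $\eta$ less than $n_{2j}$, $b^*\in B_{n,p}$; * $(n+1,m_{2j-1},0,e^*_\eta)$ with $j\ge 1$, $2j\le n+2$, $\eta\in\Gamma_n$, $w(\eta)=m_{4i-2}>n_{2j-1}^2$ for some $i\ge 1$; * $(n+1,\eta,m_{2j-1},p,e^*_\xi)$ with $j\ge 1$, $2j\le n+2$, $\eta\in\Delta_p$, $w(\eta)=m_{2j-1}$, age of $\eta$ less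 than $n_{2j-1}$, $\xi\in\Gamma_n\setminus\Gamma_p$, $w(\xi)=m_{4\sigma(\eta)}$. The weight $w$ of a tuple of one of the last four kinds is the displayed $m_h$. Its age is $1$ if it does not contain an $\eta$, and one more than the age of $\eta$ otherwise. *The space.* For $\gamma\in\Delta_{n+1}$ define $c^*_\gamma$ on $\sum_{k=1}^n\oplus(X_k\oplus\ell_\infty(\Delta_k))$ by $c^*_\gamma(\vec x)=\vec f(\vec x)$ for the first kind of tuple, $c^*_\gamma(\vec x)=\frac1{m_h}b^*(\vec x-i_{p,n}R_{[1,p]}\vec x)$ for tuples of weight $m_h$ without $\eta$, and $c^*_\gamma(\vec x)=e_\eta^*(\vec x)+\frac1{m_h}b^*(\vec x-i_{p,n}R_{[1,p]}\vec x)$ for tuples of weight $m_h$ with $\eta$. Here $R_{[1,p]}$ restricts to the first $p$ coordinates, $i_{n,n}$ is the identity, and $i_{p,n+1}(\vec x)$ extends $i_{p,n}(\vec x)$ by the $(n+1)$-st coordinate $(0,(c^*_\gamma(i_{p,n}\vec x))_{\gamma\in\Delta_{n+1}})$. Then $\|i_{p,n}\|\le2$. Let $i_p$ be the limit of $i_{p,n}$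 as $n\to\infty$, with values in $(\sum_k\oplus(X_k\oplus\ell_\infty(\Delta_k))_\infty)_\infty$, and let $\mathcal Z$ be the closure of the union of the ranges of the $i_p$. Put $P_{[1,n]}=i_nR_{[1,n]}|_{\mathcal Z}$, $P_{[1,0]}=0$, $Z_n=(P_{[1,n]}-P_{[1,n-1]})[\mathcal Z]$. A sequence $(z_k)$ in $\mathcal Z$ is *block* if $z_k\in\sum_{p_k<n\le q_k}Z_n$ for some $p_1<q_1\le p_2<q_2\le\cdots$; then $\max\operatorname{ran}z_k$ is the least $q$ with $z_k\in\sum_{n\le q}Z_n$. It is a *RIS* if it is block and there are $C>0$ and strictly increasing natural numbers $j_k$ with $\|z_k\|\le C$, $j_{k+1}>\max\operatorname{ran}z_k$, and $|e_\gamma^*(z_k)|\le C/m_i$ whenever $w(\gamma)=m_i$, $1\le i<j_k$, where $e^*_\gamma(z)$ is the $\gamma$-coordinate of $z$. **Statement.** For every sequence $(X_n)$ and all choices as above: 1. every RIS in $\mathcal Z$ is weakly null; 2. every bounded block sequence in $\mathcal Z$ is weakly null; 3. $(Z_n)$ is a shrinking Schauder decomposition of $\mathcal Z$; 4. $\mathcal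 Z^*$ is isomorphic to $(\sum_{n}\oplus(X_n^*\oplus\ell_1(\Delta_n))_1)_1$, by a linear homeomorphism $\Phi$ such that for $f\in\mathcal Z^*$ and $\Phi(f)=(x_n^*,b_n^*)_n$ one has $f(z)=\sum_n\big(x_n^*(x_n)+b_n^*(y_n)\big)$ for every $z=(x_n,y_n)_n\in\mathcal Z$. -/

import Mathlib

open Filter Topology
open scoped ENNReal

universe u

namespace AHSum

section

variable (X : ℕ → Type u) [∀ k, NormedAddCommGroup (X k)] [∀ k, NormedSpace ℝ (X k)]

/-- The tuples which are the elements of `Γ = ⋃ₙ Δₙ`.  Elements of `Γ` are labelled by natural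
numbers, in order of increasing rank, and a tuple refers to earlier elements of `Γ` by their labels.
The space `X k` (`k = 0, 1, 2, …`) is the `(k+1)`-st space of the sequence; ranks start at `1`.

* `base` is the only element of `Δ₁`;
* `zero r p f` is the tuple `(r, p, f, 0)` with `f = (f_k)_k` a finite sequence of functionals;
* `start r j p b` is the tuple `(r, m_j, p, b*)` with `b* = ∑ b_γ e_γ*`;
* `cont r j p η b` is the tuple `(r, η, m_j, p, b*)`. -/
inductive Code : Type u
  | base : Code
  | zero (r p : ℕ) (f : ∀ k, StrongDual ℝ (X k)) : Code
  | start (r j p : ℕ) (b : ℕ → ℚ) : Code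
  | cont (r j p η : ℕ) (b : ℕ → ℚ) : Code

/-- The choices made in the construction: the sequences `(m_j)`, `(n_j)` (used for `j ≥ 1`), the
sequence `(N_n)`, an enumeration of the norming sets `F_k`, and the function `σ` on (labels of)
elements of `Γ`.  The requirements on them are listed in `Parameters` below. -/
structure Data where
  m : ℕ → ℕ
  n : ℕ → ℕ
  N : ℕ → ℕ
  F : ∀ k, ℕ → StrongDual ℝ (X k)
  σ : ℕ → ℕ

end

variable {X : ℕ → Type u} [∀ k, NormedAddCommGroup (X k)] [∀ k, NormedSpace ℝ (X k)]

/-- The rank of an element of `Γ`. -/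
def Code.rank : Code X → ℕ
  | .base => 1
  | .zero r _ _ => r
  | .start r _ _ _ => r
  | .cont r _ _ _ _ => r

/-- The weight `w(γ)`.  The element of `Δ₁` has no weight, which is encoded by the value `0`. -/
def Data.weight (D : Data X) : Code X → ℕ
  | .base => 0
  | .zero _ _ _ => 1
  | .start _ j _ _ => D.m j
  | .cont _ j _ _ _ => D.m j

/-- The tuple with label `γ` in a list of tuples. -/
def codeAt (L : List (Code X)) (γ : ℕ) : Code X := L.getD γ .base

/-- The age of the element with label `γ`, that is, the length of its evaluation analysis. -/
def age (L : List (Code X)) (γ : ℕ) : ℕ :=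
  match codeAt L γ with
  | .base => 0
  | .zero _ _ _ => 0
  | .start _ _ _ _ => 1
  | .cont _ _ _ η _ => if _h : η < γ then age L η + 1 else 1
termination_by γ

/-- The set `K_{N,p}` of sequences `(f_{p+1}, …, f_N)`, extended by zero, whose entries are zero or
among the first `N` elements of the norming set, and whose norms have sum at most `1`. -/
def Data.K (D : Data X) (N p : ℕ) : Set (∀ k, StrongDual ℝ (X k)) :=
  {f | (∀ k, p ≤ k → k < N → f k = 0 ∨ ∃ i < N, f k = D.F k i) ∧
    (∀ k, ¬ (p ≤ k ∧ k < N) → f k = 0) ∧ ∑ k ∈ Finset.range N, ‖f k‖ ≤ 1}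

/-- The set `B_{N,p}` of the `b* = ∑ b_γ e_γ*` over the `γ ∈ Γ_N` of rank greater than `p`, with
rational coefficients whose denominators divide `(N_N)!` and `∑ |b_γ| ≤ 1`.  Here `L` is the list of
the elements of `Γ_N`. -/
def Data.B (D : Data X) (L : List (Code X)) (N p : ℕ) : Set (ℕ → ℚ) :=
  {b | (∀ γ, ¬ (γ < L.length ∧ p < (codeAt L γ).rank) → b γ = 0) ∧
    (∀ γ, (b γ).den ∣ (D.N N).factorial) ∧ ∑ γ ∈ Finset.range L.length, |b γ| ≤ 1}

/-- `D.IsNew N L c`: the tuple `c` belongs to `Δ_{N+1}`, for `N ≥ 1` and `L` the list of the elements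
of `Γ_N`. -/
inductive Data.IsNew (D : Data X) (N : ℕ) (L : List (Code X)) : Code X → Prop
  | zero (p : ℕ) (f : ∀ k, StrongDual ℝ (X k)) (hp : p < N) (hf : f ∈ D.K N p) :
      IsNew D N L (.zero (N + 1) p f)
  | evenStart (j p : ℕ) (b : ℕ → ℚ) (hj : 1 ≤ j) (hjN : 2 * j ≤ N + 1) (hp : p < N)
      (hb : b ∈ D.B L N p) :
      IsNew D N L (.start (N + 1) (2 * j) p b)
  | evenCont (j p η : ℕ) (b : ℕ → ℚ) (hj : 1 ≤ j) (hjN : 2 * j ≤ N + 1) (hp : p < N)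
      (hη : η < L.length) (hηp : (codeAt L η).rank = p)
      (hw : D.weight (codeAt L η) = D.m (2 * j)) (hage : age L η < D.n (2 * j))
      (hb : b ∈ D.B L N p) :
      IsNew D N L (.cont (N + 1) (2 * j) p η b)
  | oddStart (j i η : ℕ) (hj : 1 ≤ j) (hjN : 2 * j ≤ N + 2) (hη : η < L.length) (hi : 1 ≤ i)
      (hw : D.weight (codeAt L η) = D.m (4 * i - 2))
      (hbig : D.n (2 * j - 1) ^ 2 < D.m (4 * i - 2)) :
      IsNew D N L (.start (N + 1) (2 * j - 1) 0 (Pi.single η 1))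
  | oddCont (j p η ξ : ℕ) (hj : 1 ≤ j) (hjN : 2 * j ≤ N + 2)
      (hη : η < L.length) (hηp : (codeAt L η).rank = p)
      (hw : D.weight (codeAt L η) = D.m (2 * j - 1)) (hage : age L η < D.n (2 * j - 1))
      (hξ : ξ < L.length) (hpξ : p < (codeAt L ξ).rank)
      (hwξ : D.weight (codeAt L ξ) = D.m (4 * D.σ η)) :
      IsNew D N L (.cont (N + 1) (2 * j - 1) p η (Pi.single ξ 1))

theorem finite_of_support {A : ℕ → Type*} [∀ k, Zero (A k)] (N : ℕ) (T : ∀ k, Set (A k))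
    (hT : ∀ k, (T k).Finite) :
    {f : ∀ k, A k | (∀ k, f k ∈ T k) ∧ ∀ k, N ≤ k → f k = 0}.Finite := by
  have h : {g : ∀ k : Fin N, A k | ∀ k : Fin N, g k ∈ T k}.Finite := Set.Finite.pi' fun k => hT k
  refine Set.Finite.of_finite_image (f := fun f (k : Fin N) => f k) (h.subset ?_) ?_
  · rintro _ ⟨f, hf, rfl⟩ k
    exact hf.1 k
  · intro f hf g hg hfg
    funext k
    by_cases hk : k < N
    · exact congrFun hfg ⟨k, hk⟩
    · rw [hf.2 k (not_lt.mp hk), hg.2 k (not_lt.mp hk)]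

theorem finite_K (D : Data X) (N p : ℕ) : (D.K N p).Finite := by
  refine (finite_of_support N (fun k => insert 0 ((fun i => D.F k i) '' (Finset.range N : Set ℕ)))
    (fun k => ((Finset.finite_toSet _).image _).insert 0)).subset ?_
  rintro f ⟨h1, h2, -⟩
  refine ⟨fun k => ?_, fun k hk => h2 k (by omega)⟩
  by_cases hk : p ≤ k ∧ k < N
  · rcases h1 k hk.1 hk.2 with h | ⟨i, hi, h⟩
    · exact Or.inl h
    · exact Or.inr ⟨i, by simpa using hi, h.symm⟩
  · exact Or.inl (h2 k hk)

theorem finite_rat (M : ℕ) (hM : 0 < M) : {q : ℚ | q.den ∣ M ∧ |q| ≤ 1}.Finite := by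
  refine (((Finset.Icc (-(M : ℤ)) M).finite_toSet).image (fun a : ℤ => (a : ℚ) / M)).subset ?_
  rintro q ⟨⟨c, hc⟩, hq⟩
  have hM' : (0 : ℚ) < M := by exact_mod_cast hM
  have hd : (q.den : ℚ) ≠ 0 := by exact_mod_cast q.den_nz
  have hq1 : (q.num : ℚ) = q * q.den := (Rat.mul_den_eq_num q).symm
  have hc' : (M : ℚ) = q.den * c := by exact_mod_cast hc
  have key : ((q.num * c : ℤ) : ℚ) = q * M := by
    push_cast
    rw [hq1, hc']
    ring
  refine ⟨q.num * c, ?_, ?_⟩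
  · have h := abs_le.mp hq
    simp only [Finset.coe_Icc, Set.mem_Icc]
    constructor
    · have : ((-(M : ℤ) : ℤ) : ℚ) ≤ ((q.num * c : ℤ) : ℚ) := by
        rw [key]
        push_cast
        nlinarith
      exact_mod_cast this
    · have : ((q.num * c : ℤ) : ℚ) ≤ ((M : ℤ) : ℚ) := by
        rw [key]
        push_cast
        nlinarith
      exact_mod_cast this
  · change ((q.num * c : ℤ) : ℚ) / M = q
    rw [key]
    field_simp

theorem finite_B (D : Data X) (L : List (Code X)) (N p : ℕ) : (D.B L N p).Finite := by
  refine (finite_of_support L.length (fun _ => {q : ℚ | q.den ∣ (D.N N).factorial ∧ |q| ≤ 1})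
    (fun _ => finite_rat _ (Nat.factorial_pos _))).subset ?_
  rintro b ⟨h1, h2, h3⟩
  refine ⟨fun k => ⟨h2 k, ?_⟩, fun k hk => h1 k (by omega)⟩
  by_cases hk : k < L.length
  · exact (Finset.single_le_sum (f := fun γ => |b γ|) (fun _ _ => abs_nonneg _)
      (Finset.mem_range.mpr hk)).trans h3
  · rw [h1 k (by omega)]
    simp

theorem finite_isNew (D : Data X) (N : ℕ) (L : List (Code X)) :
    {c | D.IsNew N L c}.Finite := by
  have hR : ∀ M, ((Finset.range M : Finset ℕ) : Set ℕ).Finite := fun M => Finset.finite_toSet _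
  have hS : ((fun η => (Pi.single η 1 : ℕ → ℚ)) '' ((Finset.range L.length : Finset ℕ) : Set ℕ)).Finite :=
    (hR _).image _
  have hB : (⋃ p ∈ ((Finset.range N : Finset ℕ) : Set ℕ), D.B L N p).Finite :=
    (hR N).biUnion fun p _ => finite_B D L N p
  have hK : (⋃ p ∈ ((Finset.range N : Finset ℕ) : Set ℕ), D.K N p).Finite :=
    (hR N).biUnion fun p _ => finite_K D N p
  have hrank : ((fun η => (codeAt L η).rank) '' ((Finset.range L.length : Finset ℕ) : Set ℕ)).Finite :=
    (hR _).image _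
  have h1 := ((hR N).prod hK).image fun x => (Code.zero (N + 1) x.1 x.2 : Code X)
  have h2 := ((hR (N + 3)).prod ((hR (N + 1)).prod (hB.union hS))).image
    fun x => (Code.start (N + 1) x.1 x.2.1 x.2.2 : Code X)
  have h3 := ((hR (N + 3)).prod (((hR N).union hrank).prod ((hR L.length).prod (hB.union hS)))).image
    fun x => (Code.cont (N + 1) x.1 x.2.1 x.2.2.1 x.2.2.2 : Code X)
  refine ((h1.union h2).union h3).subset ?_
  rintro c (⟨p, f, hp, hf⟩ | ⟨j, p, b, hj, hjN, hp, hb⟩ |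
    ⟨j, p, η, b, hj, hjN, hp, hη, hηp, hw, hage, hb⟩ | ⟨j, i, η, hj, hjN, hη, hi, hw, hbig⟩ |
    ⟨j, p, η, ξ, hj, hjN, hη, hηp, hw, hage, hξ, hpξ, hwξ⟩)
  · exact Or.inl (Or.inl ⟨(p, f), ⟨by simpa using hp,
      Set.mem_biUnion (by simpa using hp) hf⟩, rfl⟩)
  · refine Or.inl (Or.inr ⟨(2 * j, p, b), ⟨?_, ?_, Or.inl (Set.mem_biUnion (by simpa using hp) hb)⟩,
      rfl⟩)
    · simp; omega
    · simp; omega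
  · refine Or.inr ⟨(2 * j, p, η, b), ⟨?_, Or.inl (by simpa using hp), by simpa using hη,
      Or.inl (Set.mem_biUnion (by simpa using hp) hb)⟩, rfl⟩
    simp; omega
  · refine Or.inl (Or.inr ⟨(2 * j - 1, 0, Pi.single η 1), ⟨?_, by simp,
      Or.inr ⟨η, by simpa using hη, rfl⟩⟩, rfl⟩)
    simp; omega
  · refine Or.inr ⟨(2 * j - 1, p, η, Pi.single ξ 1), ⟨?_, Or.inr ⟨η, by simpa using hη, hηp⟩,
      by simpa using hη, Or.inr ⟨ξ, by simpa using hξ, rfl⟩⟩, rfl⟩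
    simp; omega

/-- The list of the elements of `Γ_N = Δ₁ ∪ … ∪ Δ_N`; the label of an element is its position. -/
noncomputable def Data.codes (D : Data X) : ℕ → List (Code X)
  | 0 => []
  | 1 => [.base]
  | N + 2 => D.codes (N + 1) ++ (finite_isNew D (N + 1) (D.codes (N + 1))).toFinset.toList

/-- `D.Δ k` is the set of (labels of) elements of rank `k + 1`.  These are pairwise disjoint intervals
of natural numbers. -/
noncomputable def Data.Δ (D : Data X) (k : ℕ) : Finset ℕ :=
  Finset.Ico (D.codes k).length (D.codes (k + 1)).length

/-- The space `(X_k ⊕ ℓ_∞(Δ_k))_∞`. -/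
abbrev Data.E (D : Data X) (k : ℕ) : Type u := X k × (D.Δ k → ℝ)

/-- The functional `b* = ∑ b_γ e_γ*`, the sum being over `γ ∈ Γ_N`. -/
noncomputable def Data.pair (D : Data X) (N : ℕ) (b : ℕ → ℚ) : (∀ k, D.E k) →ₗ[ℝ] ℝ :=
  ∑ k ∈ Finset.range N, ∑ γ : D.Δ k,
    (b γ : ℝ) • (LinearMap.proj γ ∘ₗ LinearMap.snd ℝ (X k) (D.Δ k → ℝ) ∘ₗ LinearMap.proj k)

/-- The functional `c_γ*` on `∑_{k ≤ N} ⊕ (X_k ⊕ ℓ_∞(Δ_k))` for an element of `Δ_{N+1}` which is the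
tuple `c`.  Here `I p` is the operator `i_{p,N} R_{[1,p]}`. -/
noncomputable def Data.cstar (D : Data X) (N : ℕ) (I : ℕ → (∀ k, D.E k) →ₗ[ℝ] (∀ k, D.E k)) :
    Code X → ((∀ k, D.E k) →ₗ[ℝ] ℝ)
  | .base => 0
  | .zero _ _ f => ∑ k ∈ Finset.range N,
      (f k).toLinearMap ∘ₗ LinearMap.fst ℝ (X k) (D.Δ k → ℝ) ∘ₗ LinearMap.proj k
  | .start _ j p b => (D.m j : ℝ)⁻¹ • (D.pair N b ∘ₗ (LinearMap.id - I p))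
  | .cont _ j p η b =>
      D.pair N (Pi.single η 1) + (D.m j : ℝ)⁻¹ • (D.pair N b ∘ₗ (LinearMap.id - I p))

/-- `D.ext N p` is `i_{p,N} R_{[1,p]}` for `p ≤ N` and `R_{[1,N]}` for `p > N`.  Vectors of the sum of
the first `N` spaces are regarded as sequences that vanish from the index `N` on. -/
noncomputable def Data.ext (D : Data X) : ℕ → ℕ → (∀ k, D.E k) →ₗ[ℝ] (∀ k, D.E k)
  | 0, _ => 0
  | N + 1, p =>
    if p ≤ N then
      LinearMap.pi fun k =>
        if k = N then
          LinearMap.inr ℝ (X k) (D.Δ k → ℝ) ∘ₗ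
            LinearMap.pi (fun γ : D.Δ k =>
              D.cstar N (D.ext N) (codeAt (D.codes (N + 1)) γ)) ∘ₗ D.ext N p
        else LinearMap.proj k ∘ₗ D.ext N p
    else LinearMap.pi fun k => if k ≤ N then LinearMap.proj k else 0

/-- The requirements on the choices.  The growth conditions on `(m_j)` and `(n_j)`, `j ≥ 1`, imply
that both sequences are strictly increasing and that `n_j ≥ m_j ^ 2`. -/
structure Parameters (X : ℕ → Type u) [∀ k, NormedAddCommGroup (X k)]
    [∀ k, NormedSpace ℝ (X k)] extends Data X where
  four_le_m : 4 ≤ m 1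
  m_sq_le : ∀ j, 1 ≤ j → m j ^ 2 ≤ m (j + 1)
  m_sq_le_n : m 1 ^ 2 ≤ n 1
  n_growth : ∀ j, 1 ≤ j → (16 * n j : ℝ) ^ Real.logb 2 (m (j + 1)) ≤ n (j + 1)
  N_strictMono : StrictMono N
  F_norm_le : ∀ k i, ‖F k i‖ ≤ 1
  F_symm : ∀ k i, ∃ i', F k i' = -F k i
  F_norming : ∀ k (x : X k), IsLUB (Set.range fun i => |F k i x|) ‖x‖
  σ_base : σ 0 = 2
  σ_injOn : ∀ k, Set.InjOn σ (toData.Δ k)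
  σ_lt : ∀ k, ∀ γ ∈ toData.Δ k, ∀ γ' ∈ toData.Δ (k + 1), σ γ < σ γ'

section bound

variable (D : Data X)

theorem length_le_succ (N : ℕ) : (D.codes N).length ≤ (D.codes (N + 1)).length := by
  cases N with
  | zero => simp [Data.codes]
  | succ N => simp [Data.codes]

theorem length_mono {N M : ℕ} (h : N ≤ M) : (D.codes N).length ≤ (D.codes M).length :=
  monotone_nat_of_le_succ (length_le_succ D) h

theorem codeAt_mono {N M : ℕ} (h : N ≤ M) {γ : ℕ} (hγ : γ < (D.codes N).length) :
    codeAt (D.codes M) γ = codeAt (D.codes N) γ := by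
  induction M, h using Nat.le_induction with
  | base => rfl
  | succ M hM ih =>
    rw [← ih]
    have h1 : γ < (D.codes M).length := hγ.trans_le (length_mono D hM)
    cases M with
    | zero => simp [Data.codes] at h1
    | succ M =>
      rw [codeAt, Data.codes, List.getD_append _ _ _ _ h1]
      rfl

theorem isNew_of_mem {N γ : ℕ} (h : γ ∈ D.Δ (N + 1)) :
    D.IsNew (N + 1) (D.codes (N + 1)) (codeAt (D.codes (N + 2)) γ) := by
  rw [Data.Δ, Finset.mem_Ico] at h
  have h2 := h.2
  rw [codeAt, Data.codes, List.getD_append_right _ _ _ _ h.1]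
  rw [Data.codes, List.length_append] at h2
  rw [List.getD_eq_getElem _ _ (by omega)]
  have := List.getElem_mem (l := (finite_isNew D (N + 1) (D.codes (N + 1))).toFinset.toList)
    (n := γ - (D.codes (N + 1)).length) (by omega)
  rw [Finset.mem_toList, Set.Finite.mem_toFinset] at this
  exact this

theorem rank_eq {k N γ : ℕ} (hk : k < N) (h : γ ∈ D.Δ k) :
    (codeAt (D.codes N) γ).rank = k + 1 := by
  have h' := h
  rw [Data.Δ, Finset.mem_Ico] at h'
  rw [codeAt_mono D (Nat.succ_le_of_lt hk) h'.2]
  cases k with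
  | zero =>
    have : γ = 0 := by simp [Data.codes] at h'; omega
    subst this
    rfl
  | succ k =>
    have := isNew_of_mem D h
    generalize codeAt (D.codes (k + 2)) γ = c at this
    cases this <;> rfl

theorem sum_Δ (g : ℕ → ℝ) (N : ℕ) :
    ∑ k ∈ Finset.range N, ∑ γ : D.Δ k, g γ = ∑ γ ∈ Finset.range (D.codes N).length, g γ := by
  induction N with
  | zero => simp [Data.codes]
  | succ N ih =>
    rw [Finset.sum_range_succ, ih, Finset.sum_coe_sort (D.Δ N) g, Data.Δ,
      Finset.sum_range_add_sum_Ico _ (length_le_succ D N)]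

theorem pair_apply (N : ℕ) (b : ℕ → ℚ) (v : ∀ k, D.E k) :
    D.pair N b v = ∑ k ∈ Finset.range N, ∑ γ : D.Δ k, (b γ : ℝ) * (v k).2 γ := by
  simp [Data.pair, LinearMap.sum_apply]

theorem abs_pair_le (N : ℕ) (b : ℕ → ℚ) (v : ∀ k, D.E k) (C : ℝ)
    (hb : ∑ γ ∈ Finset.range (D.codes N).length, |b γ| ≤ 1) (hC : 0 ≤ C)
    (hv : ∀ k < N, ∀ γ : D.Δ k, b γ ≠ 0 → |(v k).2 γ| ≤ C) : |D.pair N b v| ≤ C := by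
  rw [pair_apply]
  have hb' : ∑ γ ∈ Finset.range (D.codes N).length, |(b γ : ℝ)| ≤ 1 := by exact_mod_cast hb
  calc |∑ k ∈ Finset.range N, ∑ γ : D.Δ k, (b γ : ℝ) * (v k).2 γ|
      ≤ ∑ k ∈ Finset.range N, ∑ γ : D.Δ k, |(b γ : ℝ)| * C := by
        refine (Finset.abs_sum_le_sum_abs _ _).trans (Finset.sum_le_sum fun k hk => ?_)
        refine (Finset.abs_sum_le_sum_abs _ _).trans (Finset.sum_le_sum fun γ _ => ?_)
        rw [abs_mul]
        by_cases h : b γ = 0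
        · simp [h]
        · exact mul_le_mul_of_nonneg_left (hv k (Finset.mem_range.mp hk) γ h) (abs_nonneg _)
    _ = (∑ γ ∈ Finset.range (D.codes N).length, |(b γ : ℝ)|) * C := by
        rw [sum_Δ D (fun γ => |(b γ : ℝ)| * C), Finset.sum_mul]
    _ ≤ C := by nlinarith

theorem sum_single_le (L η : ℕ) :
    ∑ γ ∈ Finset.range L, |(Pi.single η 1 : ℕ → ℚ) γ| ≤ 1 := by
  have : ∀ γ, |(Pi.single η 1 : ℕ → ℚ) γ| = if γ = η then 1 else 0 := fun γ => by
    by_cases h : γ = η <;> simp [h]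
  simp only [this, Finset.sum_ite_eq']
  split_ifs <;> norm_num

theorem ext_succ_of_lt {N p : ℕ} (h : N < p) (v : ∀ k, D.E k) (k : ℕ) :
    D.ext (N + 1) p v k = if k ≤ N then v k else 0 := by
  rw [Data.ext, if_neg (not_le.mpr h), LinearMap.pi_apply]
  split_ifs <;> rfl

theorem ext_succ_of_ne {N p k : ℕ} (h : p ≤ N) (hk : k ≠ N) (v : ∀ k, D.E k) :
    D.ext (N + 1) p v k = D.ext N p v k := by
  rw [Data.ext, if_pos h, LinearMap.pi_apply, if_neg hk]
  rfl

theorem ext_succ_self {N p : ℕ} (h : p ≤ N) (v : ∀ k, D.E k) :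
    D.ext (N + 1) p v N =
      ((0, fun γ => D.cstar N (D.ext N) (codeAt (D.codes (N + 1)) γ) (D.ext N p v)) : D.E N) := by
  rw [Data.ext, if_pos h, LinearMap.pi_apply, if_pos rfl]
  rfl

theorem ext_of_ge {N p k : ℕ} (hk : N ≤ k) (v : ∀ k, D.E k) : D.ext N p v k = 0 := by
  induction N with
  | zero => rfl
  | succ N ih =>
    rcases le_or_gt p N with h | h
    · rw [ext_succ_of_ne D h (by omega), ih (by omega)]
    · rw [ext_succ_of_lt D h, if_neg (by omega)]

theorem ext_of_lt {N p k : ℕ} (hk : k < N) (hp : k < p) (v : ∀ k, D.E k) :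
    D.ext N p v k = v k := by
  induction N with
  | zero => omega
  | succ N ih =>
    rcases le_or_gt p N with h | h
    · rw [ext_succ_of_ne D h (by omega), ih (by omega)]
    · rw [ext_succ_of_lt D h, if_pos (by omega)]

theorem ext_fst {N p k : ℕ} (hp : p ≤ k) (v : ∀ k, D.E k) : (D.ext N p v k).1 = 0 := by
  induction N with
  | zero => rfl
  | succ N ih =>
    rcases le_or_gt p N with h | h
    · rcases eq_or_ne k N with rfl | hk
      · rw [ext_succ_self D h]
      · rw [ext_succ_of_ne D h hk, ih]
    · rw [ext_succ_of_lt D h, if_neg (by omega)]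
      rfl

theorem ext_congr {N p : ℕ} {v w : ∀ k, D.E k} (h : ∀ k < p, k < N → v k = w k) :
    D.ext N p v = D.ext N p w := by
  induction N with
  | zero => rfl
  | succ N ih =>
    funext k
    rcases le_or_gt p N with hp | hp
    · have ih' := ih fun k hk _ => h k hk (by omega)
      rcases eq_or_ne k N with rfl | hk
      · rw [ext_succ_self D hp, ext_succ_self D hp, ih']
      · rw [ext_succ_of_ne D hp hk, ext_succ_of_ne D hp hk, ih']
    · rw [ext_succ_of_lt D hp, ext_succ_of_lt D hp]
      split_ifs with hk
      · exact h k (by omega) (by omega)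
      · rfl

theorem ext_ext {N n p : ℕ} (h : n ≤ p) (v : ∀ k, D.E k) :
    D.ext N p (D.ext N n v) = D.ext N n v := by
  induction N with
  | zero => rfl
  | succ N ih =>
    funext k
    rcases le_or_gt p N with hp | hp
    · have hn : n ≤ N := h.trans hp
      have e : D.ext N p (D.ext (N + 1) n v) = D.ext N n v := by
        rw [← ih]
        refine (ext_congr D fun k hk hkN => ?_).trans (congrArg _ ih)
        rw [ih, ext_succ_of_ne D hn (by omega)]
      rcases eq_or_ne k N with rfl | hk
      · rw [ext_succ_self D hp, ext_succ_self D hn, e]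
      · rw [ext_succ_of_ne D hp hk, ext_succ_of_ne D hn hk, e]
    · rw [ext_succ_of_lt D hp]
      split_ifs with hk
      · rfl
      · rw [ext_of_ge D (by omega)]

theorem abs_snd_le (k : ℕ) (x : D.E k) (γ : D.Δ k) : |x.2 γ| ≤ ‖x‖ :=
  (norm_le_pi_norm x.2 γ).trans (norm_snd_le x)

end bound

theorem Parameters.four_le (D : Parameters X) {j : ℕ} (hj : 1 ≤ j) : 4 ≤ D.m j := by
  induction j, hj using Nat.le_induction with
  | base => exact D.four_le_m
  | succ j hj ih => nlinarith [D.m_sq_le j hj]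

/-- The operators `i_{n,N}` have norm at most `2`. -/
theorem Parameters.norm_ext_le (D : Parameters X) (N n : ℕ) (v : ∀ k, D.E k) (C : ℝ) (hC : 0 ≤ C)
    (hv : ∀ k < n, ‖v k‖ ≤ C) (k : ℕ) : ‖D.ext N n v k‖ ≤ 2 * C := by
  induction N generalizing n v C k with
  | zero =>
    change ‖(0 : D.E k)‖ ≤ _
    rw [norm_zero]
    positivity
  | succ N ih =>
    rcases lt_or_ge N n with hn | hn
    · rw [ext_succ_of_lt _ hn]
      split_ifs with hk
      · linarith [hv k (by omega)]
      · rw [norm_zero]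
        positivity
    rcases ne_or_eq k N with hk | rfl
    · rw [ext_succ_of_ne _ hn hk]
      exact ih n v C hC hv k
    rw [ext_succ_self _ hn]
    set w := D.ext k n v with hw
    have hw2 : ∀ l, ‖w l‖ ≤ 2 * C := ih n v C hC hv
    -- the part of `c_γ*` which contains `b*`
    have key : ∀ (j p : ℕ) (b : ℕ → ℚ), 1 ≤ j → p ≤ k →
        ∑ γ ∈ Finset.range (D.codes k).length, |b γ| ≤ 1 →
        |(D.m j : ℝ)⁻¹ * D.pair k b (w - D.ext k p w)| ≤ if n ≤ p then 0 else C := by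
      intro j p b hj hp hb
      have hm : (4 : ℝ) ≤ D.m j := by exact_mod_cast D.four_le hj
      split_ifs with hnp
      · rw [hw, ext_ext _ hnp, sub_self, map_zero, mul_zero, abs_zero]
      · have e : D.ext k p w = D.ext k p v :=
          ext_congr _ fun l hl hlk => ext_of_lt _ hlk (by omega) v
        have hb2 : |D.pair k b (w - D.ext k p w)| ≤ 4 * C := by
          refine abs_pair_le _ _ _ _ _ hb (by positivity) fun l _ γ _ => ?_
          refine (abs_snd_le _ l _ γ).trans ((norm_sub_le _ _).trans ?_)
          rw [e]
          linarith [hw2 l, ih p v C hC (fun l hl => hv l (by omega)) l]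
        rw [abs_mul, abs_inv, abs_of_pos (by linarith : (0 : ℝ) < D.m j),
          inv_mul_le_iff₀ (by linarith)]
        nlinarith
    -- the part `e_η*`
    have hη : ∀ p η : ℕ, (codeAt (D.codes k) η).rank = p →
        |D.pair k (Pi.single η 1) w| ≤ if n ≤ p then 2 * C else C := by
      intro p η hr
      refine abs_pair_le _ _ _ _ _ (sum_single_le _ _) (by split_ifs <;> positivity) ?_
      intro l hl γ hγ
      have hγη : (γ : ℕ) = η := by
        by_contra h
        exact hγ (Pi.single_eq_of_ne h _)
      refine (abs_snd_le _ l _ γ).trans ?_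
      split_ifs with hnp
      · exact hw2 l
      · have := rank_eq D.toData hl γ.2
        rw [hγη, hr] at this
        rw [hw, ext_of_lt _ hl (by omega)]
        exact hv l (by omega)
    rw [Prod.norm_def, norm_zero]
    refine max_le (by positivity) ((pi_norm_le_iff_of_nonneg (by positivity)).mpr fun γ => ?_)
    rw [Real.norm_eq_abs]
    change |D.cstar k (D.ext k) (codeAt (D.codes (k + 1)) γ) w| ≤ 2 * C
    cases k with
    | zero =>
      have h0 : (γ : ℕ) = 0 := by
        have := γ.2
        simp [Data.Δ, Data.codes] at this
        omega
      rw [h0]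
      change |(0 : ℝ)| ≤ _
      rw [abs_zero]
      positivity
    | succ k =>
      have hnew := isNew_of_mem D.toData γ.2
      generalize codeAt (D.codes (k + 1 + 1)) γ = c at hnew
      have hstart : ∀ (r j p : ℕ) (b : ℕ → ℚ), 1 ≤ j → p ≤ k + 1 →
          ∑ γ ∈ Finset.range (D.codes (k + 1)).length, |b γ| ≤ 1 →
          |D.cstar (k + 1) (D.ext (k + 1)) (.start r j p b) w| ≤ 2 * C := by
        intro r j p b hj hp hb
        have := key j p b hj hp hb
        refine (this : |D.cstar (k + 1) (D.ext (k + 1)) (.start r j p b) w| ≤ _).trans ?_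
        split_ifs <;> linarith
      have hcont : ∀ (r j p η : ℕ) (b : ℕ → ℚ), 1 ≤ j → p ≤ k + 1 →
          (codeAt (D.codes (k + 1)) η).rank = p →
          ∑ γ ∈ Finset.range (D.codes (k + 1)).length, |b γ| ≤ 1 →
          |D.cstar (k + 1) (D.ext (k + 1)) (.cont r j p η b) w| ≤ 2 * C := by
        intro r j p η b hj hp hr hb
        have h1 := key j p b hj hp hb
        have h2 := hη p η hr
        have h3 : |D.cstar (k + 1) (D.ext (k + 1)) (.cont r j p η b) w| ≤
          |D.pair (k + 1) (Pi.single η 1) w| +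
            |(D.m j : ℝ)⁻¹ * D.pair (k + 1) b (w - D.ext (k + 1) p w)| := abs_add_le _ _
        split_ifs at h1 h2 <;> linarith
      cases hnew with
      | zero p f hp hf =>
        have e : D.cstar (k + 1) (D.ext (k + 1)) (.zero (k + 1 + 1) p f) w =
            ∑ l ∈ Finset.range (k + 1), f l (w l).1 := by
          simp [Data.cstar, LinearMap.sum_apply]
        rw [e]
        have : ∀ l ∈ Finset.range (k + 1), |f l (w l).1| ≤ ‖f l‖ * C := by
          intro l hl
          refine ((f l).le_opNorm _).trans (mul_le_mul_of_nonneg_left ?_ (norm_nonneg _))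
          rcases lt_or_ge l n with hln | hln
          · rw [hw, ext_of_lt _ (Finset.mem_range.mp hl) hln]
            exact (norm_fst_le _).trans (hv l hln)
          · rw [hw, ext_fst _ hln, norm_zero]
            exact hC
        have h1 := (Finset.abs_sum_le_sum_abs _ _).trans (Finset.sum_le_sum this)
        rw [← Finset.sum_mul] at h1
        nlinarith [hf.2.2]
      | evenStart j p b hj hjN hp hb => exact hstart _ _ _ _ (by omega) hp.le hb.2.2
      | evenCont j p η b hj hjN hp hη hηp hw hage hb =>
        exact hcont _ _ _ _ _ (by omega) hp.le hηp hb.2.2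
      | oddStart j i η hj hjN hη hi hw hbig =>
        exact hstart _ _ _ _ (by omega) (by omega) (sum_single_le _ _)
      | oddCont j p η ξ hj hjN hη hηp hw hage hξ hpξ hwξ =>
        refine hcont _ _ _ _ _ (by omega) ?_ hηp (sum_single_le _ _)
        have : ∃ l < k + 1, ξ ∈ D.Δ l := by
          by_contra hcon
          push Not at hcon
          have hall : ∀ l ≤ k + 1, (D.codes l).length ≤ ξ := by
            intro l
            induction l with
            | zero => intro _; simp [Data.codes]
            | succ l ihl =>
              intro hl
              by_contra hlt
              exact hcon l (by omega) (Finset.mem_Ico.mpr ⟨ihl (by omega), by omega⟩)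
          exact absurd (hall _ le_rfl) (by omega)
        obtain ⟨l, hl, hξl⟩ := this
        have := rank_eq D.toData hl hξl
        omega

/-- The ambient space `(∑ₙ ⊕ (Xₙ ⊕ ℓ_∞(Δₙ))_∞)_∞`. -/
abbrev Parameters.Ambient (D : Parameters X) : Type u := lp (fun k => D.E k) ∞

/-- Extension by zero of a vector of the sum of the first `n` spaces. -/
def Parameters.extendZero (D : Parameters X) (n : ℕ) :
    (∀ k : Fin n, D.E k) →ₗ[ℝ] (∀ k, D.E k) :=
  LinearMap.pi fun k => if h : k < n then LinearMap.proj (⟨k, h⟩ : Fin n) else 0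

theorem Parameters.norm_extendZero_le (D : Parameters X) (n : ℕ) (u : ∀ k : Fin n, D.E k)
    (k : ℕ) (hk : k < n) : ‖D.extendZero n u k‖ ≤ ‖u‖ := by
  have : D.extendZero n u k = u ⟨k, hk⟩ := by
    rw [Parameters.extendZero, LinearMap.pi_apply, dif_pos hk]
    rfl
  rw [this]
  exact norm_le_pi_norm u ⟨k, hk⟩

/-- The operator `iₙ`, the limit of the operators `i_{n,m}` as `m → ∞`. -/
noncomputable def Parameters.i (D : Parameters X) (n : ℕ) :
    (∀ k : Fin n, D.E k) →L[ℝ] D.Ambient :=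
  LinearMap.mkContinuous
    { toFun := fun u => ⟨fun k => D.ext (k + 1) n (D.extendZero n u) k,
        memℓp_infty ⟨2 * ‖u‖, by
          rintro _ ⟨k, rfl⟩
          exact D.norm_ext_le _ _ _ _ (norm_nonneg _) (D.norm_extendZero_le n u) k⟩⟩
      map_add' := fun u v => by
        ext1
        funext k
        simp only [map_add]
        rfl
      map_smul' := fun a u => by
        ext1
        funext k
        simp [map_smul] }
    2 fun u => lp.norm_le_of_forall_le (by positivity) fun k =>
      D.norm_ext_le _ _ _ _ (norm_nonneg _) (D.norm_extendZero_le n u) k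

/-- The restriction `R_{[1,n]}` to the first `n` coordinates. -/
noncomputable def Parameters.R (D : Parameters X) (n : ℕ) :
    D.Ambient →L[ℝ] (∀ k : Fin n, D.E k) :=
  LinearMap.mkContinuous
    { toFun := fun z k => z k
      map_add' := fun _ _ => rfl
      map_smul' := fun _ _ => rfl }
    1 fun z => by
      rw [one_mul]
      exact (pi_norm_le_iff_of_nonneg (norm_nonneg _)).mpr fun k =>
        lp.norm_apply_le_norm (by simp) z k

/-- The space `𝒵 = (∑ₙ ⊕ Xₙ)_AH`, the closure of the union of the increasing sequence of the
subspaces `Yₙ = range iₙ`. -/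
noncomputable def Parameters.Z (D : Parameters X) : Submodule ℝ D.Ambient :=
  (⨆ n, LinearMap.range (D.i n).toLinearMap).topologicalClosure

theorem Parameters.i_mem (D : Parameters X) (n : ℕ) (u : ∀ k : Fin n, D.E k) : D.i n u ∈ D.Z :=
  Submodule.le_topologicalClosure _
    (Submodule.mem_iSup_of_mem (p := fun n => LinearMap.range (D.i n).toLinearMap) n ⟨u, rfl⟩)

/-- The projection `P_{[1,n]} = iₙ R_{[1,n]}` of `𝒵`. -/
noncomputable def Parameters.P (D : Parameters X) (n : ℕ) : D.Z →L[ℝ] D.Z :=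
  (D.i n ∘L D.R n ∘L D.Z.subtypeL).codRestrict D.Z fun _ => D.i_mem n _

/-- The component `Z_{n+1}` of the decomposition of `𝒵`, the image of the projection
`P_{[1,n+1]} - P_{[1,n]}`. -/
noncomputable def Parameters.component (D : Parameters X) (n : ℕ) : Submodule ℝ D.Z :=
  LinearMap.range (D.P (n + 1) - D.P n).toLinearMap

/-- The subspace `Z_{p+1} + … + Z_q` of `𝒵`. -/
noncomputable def Parameters.segment (D : Parameters X) (p q : ℕ) : Submodule ℝ D.Z :=
  ⨆ n ∈ Finset.Ico p q, D.component n

/-- `max ran z`, for vectors `z` of finite range. -/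
noncomputable def Parameters.maxRan (D : Parameters X) (z : D.Z) : ℕ :=
  sInf {q | z ∈ D.segment 0 q}

/-- `(z_k)` is a (horizontally) block sequence: the ranges of the `z_k` are contained in successive
intervals `(p_k, q_k]`. -/
def Parameters.IsBlock (D : Parameters X) (z : ℕ → D.Z) : Prop :=
  ∃ p q : ℕ → ℕ, ∀ k, p k < q k ∧ q k ≤ p (k + 1) ∧ z k ∈ D.segment (p k) (q k)

/-- `(z_k)` is a `C`-RIS (rapidly increasing sequence).  For an element `γ` of rank `l + 1`, the value
of `e_γ*` at `z_k` is the coordinate `((z k : D.Ambient) l).2 γ`. -/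
def Parameters.IsRISWith (D : Parameters X) (C : ℝ) (z : ℕ → D.Z) : Prop :=
  D.IsBlock z ∧ ∃ j : ℕ → ℕ, StrictMono j ∧ (∀ k, ‖z k‖ ≤ C) ∧
    (∀ k, D.maxRan (z k) < j (k + 1)) ∧
    ∀ (k l : ℕ) (γ : D.Δ l) (i : ℕ), 1 ≤ i → i < j k →
      D.weight (codeAt (D.codes (l + 1)) γ) = D.m i → |((z k : D.Ambient) l).2 γ| ≤ C / D.m i

/-- `(z_k)` is a RIS if it is a `C`-RIS for some constant `C > 0`. -/
def Parameters.IsRIS (D : Parameters X) (z : ℕ → D.Z) : Prop :=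
  ∃ C > 0, D.IsRISWith C z

/-- The `ℓ₁`-sum of the spaces `(Xₙ* ⊕ ℓ₁(Δₙ))₁`. -/
abbrev Parameters.DualSum (D : Parameters X) : Type u :=
  lp (fun k => WithLp 1 (StrongDual ℝ (X k) × PiLp 1 (fun _ : D.Δ k => ℝ))) 1

section

variable {W : Type u} [NormedAddCommGroup W] [NormedSpace ℝ W]

/-- Weakly null sequences. -/
def WeaklyNull (z : ℕ → W) : Prop :=
  ∀ f : StrongDual ℝ W, Tendsto (fun k => f (z k)) atTop (𝓝 0)

/-- Schauder decompositions of a normed space into closed subspaces. -/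
def IsSchauderDecomposition (V : ℕ → Submodule ℝ W) : Prop :=
  (∀ n, IsClosed (V n : Set W)) ∧
    ∀ z, ∃! w : ℕ → W, (∀ n, w n ∈ V n) ∧
      Tendsto (fun n => ∑ k ∈ Finset.range n, w k) atTop (𝓝 z)

/-- A decomposition is shrinking if the norms of the restrictions of every bounded functional to the
closed linear spans of the tails of the decomposition tend to zero. -/
def IsShrinking (V : ℕ → Submodule ℝ W) : Prop :=
  ∀ f : StrongDual ℝ W,
    Tendsto (fun n => ‖f ∘L (⨆ k, V (n + k)).topologicalClosure.subtypeL‖) atTop (𝓝 0)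

end

end AHSum

namespace AHSum

variable {X : ℕ → Type u} [∀ k, NormedAddCommGroup (X k)] [∀ k, NormedSpace ℝ (X k)]

/-! ### Labels and coordinate functionals on the full product -/

section coordinates

variable (D : Data X)

/-! For a RIS the heart is a sublinear bound: for every ε > 0 there is M with ‖∑_{k∈A} z_k‖ ≤ ε|A| +
M for all finite sets A. If f(z_k) ≥ δ for infinitely many k, summing n of these vectors gives nδ ≤
‖f‖(εn + M), which fails for small ε and large n.

The bound is proved one coordinate at a time. If γ has rank N + 1, then e_γ* - e_γ*∘P_{[1,N]} sees
only a block vector whose range straddles N, hence at most one z_k. The remaining part is described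
by `evaluation`: it is m_i⁻¹ B(z - P_{[1,p]} z), possibly plus e_η* for a predecessor η of the same
weight, where B is dominated by the coordinates. So a bound θ|A| + M valid for all coordinates
improves, for weight m_i, to (θ/m_i)|A| plus an error proportional to the age of γ, because the
successive functionals B act on disjoint subsets of A (`abs_e_le_of_weight`). The age is at most n_i
+ 1 and m_i ≥ 4, so for any finite set of weights θ drops to θ/4 at the cost of a larger M. For
large i the RIS condition already gives a coefficient 3C/m_i < ε (`abs_e_le_of_ris`). Iterating the
two estimates brings θ down to ε.

If a bounded block sequence were not weakly null, some functional would stay above δ on a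
subsequence, up to sign. Sufficiently long averages of that subsequence form a RIS on which the
functional is still at least δ, a contradiction. A failure of shrinking produces a bounded block
sequence that is not weakly null.

The natural map from the ℓ₁-sum to the dual of 𝒵 is bounded below, so its range is closed. The range
contains every f∘P_{[1,n]}, and these converge to f in norm by the shrinking property, so the map is
onto. -/

theorem exists_mem_Δ {N γ : ℕ} (h : γ < (D.codes N).length) : ∃ l < N, γ ∈ D.Δ l := by
  induction N with
  | zero => simp [Data.codes] at h
  | succ N ih =>
    by_cases h' : γ < (D.codes N).length
    · obtain ⟨l, hl, hγ⟩ := ih h'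
      exact ⟨l, by omega, hγ⟩
    · exact ⟨N, by omega, Finset.mem_Ico.mpr ⟨by omega, h⟩⟩

theorem lt_length_of_mem_Δ {l N γ : ℕ} (hl : l < N) (h : γ ∈ D.Δ l) :
    γ < (D.codes N).length :=
  (Finset.mem_Ico.mp h).2.trans_le (length_mono D hl)

theorem Δ_unique {k l γ : ℕ} (hk : γ ∈ D.Δ k) (hl : γ ∈ D.Δ l) : k = l := by
  have h1 := rank_eq D (N := k + l + 1) (by omega) hk
  have h2 := rank_eq D (N := k + l + 1) (by omega) hl
  omega

theorem age_mono {N M : ℕ} (h : N ≤ M) {γ : ℕ} (hγ : γ < (D.codes N).length) :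
    age (D.codes M) γ = age (D.codes N) γ := by
  induction γ using Nat.strong_induction_on with
  | _ γ ih =>
    rw [age, age, codeAt_mono D h hγ]
    split
    · rfl
    · rfl
    · rfl
    · split_ifs with hlt
      · rw [ih _ hlt (hlt.trans hγ)]
      · rfl

open Classical in
/-- The coordinate functional `e_γ*` on the product of the spaces `E k`. -/
noncomputable def Data.coord (γ : ℕ) : (∀ k, D.E k) →ₗ[ℝ] ℝ :=
  if h : ∃ k, γ ∈ D.Δ k then
    LinearMap.proj ⟨γ, h.choose_spec⟩ ∘ₗ
      LinearMap.snd ℝ (X h.choose) (D.Δ h.choose → ℝ) ∘ₗ LinearMap.proj h.choose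
  else 0

theorem coord_apply {k γ : ℕ} (h : γ ∈ D.Δ k) (v : ∀ k, D.E k) :
    D.coord γ v = (v k).2 ⟨γ, h⟩ := by
  have h' : ∃ k, γ ∈ D.Δ k := ⟨k, h⟩
  obtain rfl : k = h'.choose := Δ_unique D h h'.choose_spec
  rw [Data.coord, dif_pos h']
  rfl

theorem coord_of_notMem {γ : ℕ} (h : ¬ ∃ k, γ ∈ D.Δ k) (v : ∀ k, D.E k) :
    D.coord γ v = 0 := by
  rw [Data.coord, dif_neg h]
  rfl

theorem pair_eq_sum_coord (N : ℕ) (b : ℕ → ℚ) (v : ∀ k, D.E k) :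
    D.pair N b v = ∑ γ ∈ Finset.range (D.codes N).length, (b γ : ℝ) * D.coord γ v := by
  rw [pair_apply, ← sum_Δ D (fun γ => (b γ : ℝ) * D.coord γ v)]
  exact Finset.sum_congr rfl fun k _ => Finset.sum_congr rfl fun γ _ => by
    rw [coord_apply D γ.2]

/-- Later stages of the extension never change a coordinate once it is defined. The limit operator
can therefore be read off from any stage N > k. -/
theorem ext_eq_ext_succ {N n k : ℕ} (hk : k < N) (v : ∀ k, D.E k) :
    D.ext N n v k = D.ext (k + 1) n v k := by
  induction N with
  | zero => omega
  | succ N ih =>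
    rcases eq_or_ne k N with rfl | hne
    · rfl
    · rcases le_or_gt n N with h | h
      · rw [ext_succ_of_ne D h hne, ih (by omega)]
      · rw [ext_of_lt D hk (by omega), ext_of_lt D (by omega) (by omega)]

end coordinates

/-! ### The projections P_{[1,n]}, the components and their segments -/

section projections

variable (D : Parameters X)

/-- The coordinate of a vector of `𝒵` in `E l`. -/
def Parameters.val (l : ℕ) : D.Z →ₗ[ℝ] D.E l where
  toFun z := (z : D.Ambient) l
  map_add' _ _ := rfl
  map_smul' _ _ := rfl

/-- The coordinate functional `e_γ*` on `𝒵`. -/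
noncomputable def Parameters.e (γ : ℕ) : D.Z →ₗ[ℝ] ℝ where
  toFun z := D.coord γ (z : D.Ambient)
  map_add' _ _ := map_add (D.coord γ) _ _
  map_smul' _ _ := map_smul (D.coord γ) _ _

theorem e_apply {l γ : ℕ} (h : γ ∈ D.Δ l) (z : D.Z) : D.e γ z = (D.val l z).2 ⟨γ, h⟩ :=
  coord_apply D.toData h _

theorem norm_val_le (l : ℕ) (z : D.Z) : ‖D.val l z‖ ≤ ‖z‖ :=
  lp.norm_apply_le_norm (by simp) (z : D.Ambient) l

theorem abs_e_le (γ : ℕ) (z : D.Z) : |D.e γ z| ≤ ‖z‖ := by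
  by_cases h : ∃ l, γ ∈ D.Δ l
  · obtain ⟨l, hl⟩ := h
    rw [e_apply D hl]
    exact (abs_snd_le D.toData l _ _).trans (norm_val_le D l z)
  · have : D.e γ z = 0 := coord_of_notMem D.toData h _
    rw [this, abs_zero]
    exact norm_nonneg z

theorem ext_val {z w : D.Z} (h : ∀ l, D.val l z = D.val l w) : z = w :=
  Subtype.ext (lp.ext (funext h))

theorem norm_le_of_coordinates (z : D.Z) {C : ℝ} (h1 : ∀ l, ‖(D.val l z).1‖ ≤ C)
    (h2 : ∀ γ, |D.e γ z| ≤ C) : ‖z‖ ≤ C := by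
  have hC : 0 ≤ C := (norm_nonneg _).trans (h1 0)
  refine lp.norm_le_of_forall_le hC fun l => ?_
  change ‖D.val l z‖ ≤ C
  rw [Prod.norm_def]
  refine max_le (h1 l) ((pi_norm_le_iff_of_nonneg hC).mpr fun γ => ?_)
  rw [Real.norm_eq_abs, ← e_apply D γ.2]
  exact h2 γ

theorem val_i (n : ℕ) (u : ∀ k : Fin n, D.E k) (l : ℕ) :
    D.val l ⟨D.i n u, D.i_mem n u⟩ = D.ext (l + 1) n (D.extendZero n u) l :=
  rfl

theorem extendZero_R (n : ℕ) (z : D.Ambient) {k : ℕ} (hk : k < n) :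
    D.extendZero n (D.R n z) k = z k := by
  rw [Parameters.extendZero, LinearMap.pi_apply, dif_pos hk]
  rfl

theorem val_P (n l : ℕ) (z : D.Z) : D.val l (D.P n z) = D.ext (l + 1) n (z : D.Ambient) l :=
  congrFun (ext_congr D.toData fun _ hk _ => extendZero_R D n z hk) l

theorem val_P_of_lt {n l : ℕ} (h : l < n) (z : D.Z) : D.val l (D.P n z) = D.val l z := by
  rw [val_P, ext_of_lt D.toData (by omega) h]
  rfl

/-- The extension operators add new coordinates only in ℓ_∞(Δ_l); the X-part is continued by zero.
-/
theorem fst_val_P {n l : ℕ} (h : n ≤ l) (z : D.Z) : (D.val l (D.P n z)).1 = 0 := by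
  rw [val_P]
  exact ext_fst D.toData h _

theorem P_congr {n : ℕ} {z w : D.Z} (h : ∀ l < n, D.val l z = D.val l w) :
    D.P n z = D.P n w := by
  refine ext_val D fun l => ?_
  rw [val_P, val_P]
  exact congrFun (ext_congr D.toData fun k hk _ => h k hk) l

theorem P_P_of_le {n m : ℕ} (h : n ≤ m) (z : D.Z) : D.P n (D.P m z) = D.P n z :=
  P_congr D fun _ hl => val_P_of_lt D (by omega) z

theorem P_P_of_ge {n m : ℕ} (h : n ≤ m) (z : D.Z) : D.P m (D.P n z) = D.P n z := by
  refine ext_val D fun l => ?_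
  rw [val_P, val_P, ← ext_ext D.toData h]
  refine congrFun (ext_congr D.toData fun k _ hk => ?_) l
  change D.val k (D.P n z) = _
  rw [val_P, ext_eq_ext_succ D.toData hk]

theorem P_zero (z : D.Z) : D.P 0 z = 0 := by
  refine ext_val D fun l => ?_
  rw [val_P, map_zero, ext_congr D.toData (w := 0) (by simp), map_zero]
  rfl

theorem P_i_of_le {n m : ℕ} (h : n ≤ m) (u : ∀ k : Fin n, D.E k) :
    D.P m ⟨D.i n u, D.i_mem n u⟩ = ⟨D.i n u, D.i_mem n u⟩ := by
  have : (⟨D.i n u, D.i_mem n u⟩ : D.Z) = D.P n ⟨D.i n u, D.i_mem n u⟩ := by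
    refine ext_val D fun l => ?_
    rw [val_P, val_i]
    refine congrFun (ext_congr D.toData fun k hk hkl => ?_) l
    change _ = D.ext (k + 1) n _ k
    rw [ext_of_lt D.toData (by omega) hk]
  rw [this, P_P_of_ge D h]

theorem norm_i_le (n : ℕ) (u : ∀ k : Fin n, D.E k) : ‖D.i n u‖ ≤ 2 * ‖u‖ :=
  lp.norm_le_of_forall_le (by positivity) fun _ =>
    D.norm_ext_le _ _ _ _ (norm_nonneg _) (D.norm_extendZero_le n u) _

theorem norm_P_le (n : ℕ) (z : D.Z) : ‖D.P n z‖ ≤ 2 * ‖z‖ :=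
  lp.norm_le_of_forall_le (by positivity) fun l => by
    change ‖D.val l (D.P n z)‖ ≤ _
    rw [val_P]
    exact D.norm_ext_le _ _ _ _ (norm_nonneg _) (fun k _ => norm_val_le D k z) _

theorem norm_sub_P_le (n : ℕ) (z : D.Z) : ‖z - D.P n z‖ ≤ 3 * ‖z‖ := by
  linarith [norm_sub_le z (D.P n z), norm_P_le D n z]

theorem monotone_range_i : Monotone fun n => LinearMap.range (D.i n).toLinearMap := by
  rintro n m h _ ⟨u, rfl⟩
  have := congrArg Subtype.val (P_i_of_le D h u)
  exact ⟨_, this⟩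

/-- The projections are uniformly bounded and eventually fix each element of the dense union of the
ranges of the i_n. -/
theorem tendsto_P (z : D.Z) : Tendsto (fun n => D.P n z) atTop (𝓝 z) := by
  rw [Metric.tendsto_atTop]
  intro ε hε
  have hz : (z : D.Ambient) ∈ closure
      ((⨆ n, LinearMap.range (D.i n).toLinearMap : Submodule ℝ D.Ambient) : Set D.Ambient) := z.2
  -- The factor 3 is the bound for the norm of I - P_{[1,m]}.
  obtain ⟨w, hw, hwz⟩ := Metric.mem_closure_iff.mp hz (ε / 3) (by positivity)
  obtain ⟨n, u, rfl⟩ := (Submodule.mem_iSup_of_directed _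
    (monotone_range_i D).directed_le).mp hw
  refine ⟨n, fun m hm => ?_⟩
  set v : D.Z := ⟨D.i n u, D.i_mem n u⟩ with hv
  have h1 : D.P m v = v := P_i_of_le D hm u
  have h2 : ‖z - v‖ < ε / 3 := by
    rw [← dist_eq_norm]
    exact hwz
  have h3 := norm_sub_P_le D m (z - v)
  rw [map_sub, h1] at h3
  rw [dist_comm, dist_eq_norm]
  have : z - D.P m z = z - v - (D.P m z - v) := by abel
  rw [this]
  linarith

theorem P_of_mem_component {n : ℕ} {z : D.Z} (h : z ∈ D.component n) (m : ℕ) :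
    D.P m z = if n < m then z else 0 := by
  obtain ⟨w, rfl⟩ := h
  change D.P m (D.P (n + 1) w - D.P n w) = if n < m then D.P (n + 1) w - D.P n w else 0
  rw [map_sub]
  split_ifs with hm
  · rw [P_P_of_ge D (by omega), P_P_of_ge D (by omega)]
  · rw [P_P_of_le D (by omega), P_P_of_le D (by omega), sub_self]

theorem P_of_mem_segment {p q : ℕ} {z : D.Z} (h : z ∈ D.segment p q) :
    (∀ m ≤ p, D.P m z = 0) ∧ ∀ m, q ≤ m → D.P m z = z := by
  constructor
  · intro m hm
    have : D.segment p q ≤ LinearMap.ker (D.P m).toLinearMap :=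
      iSup₂_le fun n hn w hw => by
        have := P_of_mem_component D hw m
        rw [if_neg (by have := Finset.mem_Ico.mp hn; omega)] at this
        exact this
    exact this h
  · intro m hm
    have : D.segment p q ≤ LinearMap.ker (D.P m - ContinuousLinearMap.id ℝ D.Z).toLinearMap :=
      iSup₂_le fun n hn w hw => by
        have := P_of_mem_component D hw m
        rw [if_pos (by have := Finset.mem_Ico.mp hn; omega)] at this
        exact sub_eq_zero.mpr this
    exact sub_eq_zero.mp (this h)

theorem sub_P_mem_component (n : ℕ) (z : D.Z) : D.P (n + 1) z - D.P n z ∈ D.component n :=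
  ⟨z, rfl⟩

theorem mem_segment {p q : ℕ} (hpq : p ≤ q) {z : D.Z} (hp : D.P p z = 0) (hq : D.P q z = z) :
    z ∈ D.segment p q := by
  have : z = ∑ n ∈ Finset.Ico p q, (D.P (n + 1) z - D.P n z) := by
    rw [Finset.sum_Ico_sub (fun n => D.P n z) hpq, hp, hq, sub_zero]
  rw [this]
  exact Submodule.sum_mem _ fun n hn =>
    Submodule.mem_iSup_of_mem n (Submodule.mem_iSup_of_mem hn (sub_P_mem_component D n z))

theorem segment_mono {p q p' q' : ℕ} (hp : p' ≤ p) (hq : q ≤ q') :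
    D.segment p q ≤ D.segment p' q' :=
  iSup₂_le fun n hn => le_iSup₂_of_le n
    (Finset.mem_Ico.mpr ⟨hp.trans (Finset.mem_Ico.mp hn).1, (Finset.mem_Ico.mp hn).2.trans_le hq⟩)
    le_rfl

/-- Membership in some segment makes the set in the infimum nonempty, so `maxRan` is attained and is
not the default value 0. -/
theorem P_maxRan {p q : ℕ} {z : D.Z} (h : z ∈ D.segment p q) {m : ℕ} (hm : D.maxRan z ≤ m) :
    D.P m z = z := by
  have hne : {q | z ∈ D.segment 0 q}.Nonempty := ⟨q, segment_mono D (Nat.zero_le _) le_rfl h⟩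
  exact (P_of_mem_segment D (Nat.sInf_mem hne)).2 m hm

theorem maxRan_le {p q : ℕ} {z : D.Z} (h : z ∈ D.segment p q) : D.maxRan z ≤ q :=
  Nat.sInf_le (segment_mono D (Nat.zero_le _) le_rfl h)

end projections

end AHSum

namespace AHSum

variable {X : ℕ → Type u} [∀ k, NormedAddCommGroup (X k)] [∀ k, NormedSpace ℝ (X k)]

/-! ### Weight and age of an element of Γ -/

section labels

variable (D : Data X)

open Classical in
/-- The weight of the element of `Γ` with label `γ`. -/
noncomputable def Data.wt (γ : ℕ) : ℕ :=
  if h : ∃ k, γ ∈ D.Δ k then D.weight (codeAt (D.codes (h.choose + 1)) γ) else 0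

open Classical in
/-- The age of the element of `Γ` with label `γ`. -/
noncomputable def Data.ageOf (γ : ℕ) : ℕ :=
  if h : ∃ k, γ ∈ D.Δ k then age (D.codes (h.choose + 1)) γ else 0

theorem wt_eq {l N γ : ℕ} (h : γ ∈ D.Δ l) (hl : l < N) :
    D.wt γ = D.weight (codeAt (D.codes N) γ) := by
  have h' : ∃ k, γ ∈ D.Δ k := ⟨l, h⟩
  rw [Data.wt, dif_pos h', Δ_unique D h'.choose_spec h,
    codeAt_mono D hl (lt_length_of_mem_Δ D (Nat.lt_succ_self l) h)]

theorem ageOf_eq {l N γ : ℕ} (h : γ ∈ D.Δ l) (hl : l < N) :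
    D.ageOf γ = age (D.codes N) γ := by
  have h' : ∃ k, γ ∈ D.Δ k := ⟨l, h⟩
  rw [Data.ageOf, dif_pos h', Δ_unique D h'.choose_spec h,
    age_mono D hl (lt_length_of_mem_Δ D (Nat.lt_succ_self l) h)]

theorem lt_of_mem_Δ {k l γ η : ℕ} (hkl : l < k) (hγ : γ ∈ D.Δ k) (hη : η ∈ D.Δ l) : η < γ :=
  (lt_length_of_mem_Δ D hkl hη).trans_le (Finset.mem_Ico.mp hγ).1

end labels

theorem Parameters.m_lt (D : Parameters X) {i j : ℕ} (hi : 1 ≤ i) (hij : i < j) :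
    D.m i < D.m j := by
  induction j, hij using Nat.le_induction with
  | base => nlinarith [D.m_sq_le i hi, D.four_le hi]
  | succ j hj ih => nlinarith [D.m_sq_le j (by omega), D.four_le (show 1 ≤ j by omega)]

theorem Parameters.m_inj (D : Parameters X) {i j : ℕ} (hi : 1 ≤ i) (hj : 1 ≤ j)
    (h : D.m i = D.m j) : i = j := by
  rcases lt_trichotomy i j with hij | hij | hij
  · exact absurd h (D.m_lt hi hij).ne
  · exact hij
  · exact absurd h (D.m_lt hj hij).ne'

theorem Parameters.le_m (D : Parameters X) {i : ℕ} (hi : 1 ≤ i) : i ≤ D.m i := by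
  induction i, hi using Nat.le_induction with
  | base => linarith [D.four_le_m]
  | succ i hi ih => have := D.m_lt hi (Nat.lt_add_one i); omega

/-! ### Evaluation analysis of the coordinate functionals -/

section evaluation

variable (D : Parameters X)

/-- The functionals of the form `∑ b_γ e_γ*` with `∑ |b_γ| ≤ 1`, through the property used of them. -/
def Parameters.Dominated (B : D.Z →ₗ[ℝ] ℝ) : Prop :=
  ∀ z K, (∀ γ, |D.e γ z| ≤ K) → |B z| ≤ K

theorem Parameters.Dominated.abs_le {D : Parameters X} {B : D.Z →ₗ[ℝ] ℝ} (h : D.Dominated B) (z : D.Z) :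
    |B z| ≤ ‖z‖ :=
  h z _ fun γ => abs_e_le D γ z

/-- The functional `∑ b_γ e_γ*` on `𝒵`, the sum being over `γ ∈ Γ_N`. -/
noncomputable def Parameters.comb (N : ℕ) (b : ℕ → ℚ) : D.Z →ₗ[ℝ] ℝ :=
  ∑ γ ∈ Finset.range (D.codes N).length, (b γ : ℝ) • D.e γ

theorem comb_apply (N : ℕ) (b : ℕ → ℚ) (z : D.Z) :
    D.comb N b z = ∑ γ ∈ Finset.range (D.codes N).length, (b γ : ℝ) * D.e γ z := by
  simp [Parameters.comb, LinearMap.sum_apply]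

theorem dominated_comb {N : ℕ} {b : ℕ → ℚ}
    (hb : ∑ γ ∈ Finset.range (D.codes N).length, |b γ| ≤ 1) : D.Dominated (D.comb N b) := by
  intro z K hK
  have hK0 : 0 ≤ K := (abs_nonneg _).trans (hK 0)
  have hb' : ∑ γ ∈ Finset.range (D.codes N).length, |(b γ : ℝ)| ≤ 1 := by exact_mod_cast hb
  rw [comb_apply]
  calc |∑ γ ∈ Finset.range (D.codes N).length, (b γ : ℝ) * D.e γ z|
      ≤ ∑ γ ∈ Finset.range (D.codes N).length, |(b γ : ℝ)| * K :=
        (Finset.abs_sum_le_sum_abs _ _).trans (Finset.sum_le_sum fun γ _ => by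
          rw [abs_mul]
          exact mul_le_mul_of_nonneg_left (hK γ) (abs_nonneg _))
    _ ≤ K := by
        rw [← Finset.sum_mul]
        exact mul_le_of_le_one_left hK0 hb'

/-- The sum reads only coordinates of rank at most N, and there i_{p,N}R_{[1,p]} agrees with
P_{[1,p]}. This turns the recursive definition of c_γ* into a formula on 𝒵. -/
theorem pair_sub_ext (N p : ℕ) (b : ℕ → ℚ) (z : D.Z) :
    D.pair N b (D.ext N N (z : D.Ambient) - D.ext N p (D.ext N N (z : D.Ambient))) =
      D.comb N b (z - D.P p z) := by
  rw [pair_eq_sum_coord, comb_apply]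
  refine Finset.sum_congr rfl fun γ hγ => ?_
  obtain ⟨l, hl, hγl⟩ := exists_mem_Δ D.toData (Finset.mem_range.mp hγ)
  rw [e_apply D hγl, coord_apply D.toData hγl, map_sub, val_P, Pi.sub_apply,
    ext_of_lt D.toData hl hl,
    ext_congr D.toData (w := (z : D.Ambient)) (fun k hk hkN => ext_of_lt D.toData hkN (by omega) _),
    ext_eq_ext_succ D.toData hl]
  rfl

theorem pair_single_ext {N η : ℕ} (hη : η < (D.codes N).length) (z : D.Z) :
    D.pair N (Pi.single η 1) (D.ext N N (z : D.Ambient)) = D.e η z := by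
  rw [pair_eq_sum_coord, Finset.sum_eq_single_of_mem η (Finset.mem_range.mpr hη)]
  · obtain ⟨l, hl, hηl⟩ := exists_mem_Δ D.toData hη
    rw [e_apply D hηl, coord_apply D.toData hηl, ext_of_lt D.toData hl hl, Pi.single_eq_same]
    simp only [Rat.cast_one, one_mul]
    rfl
  · intro γ _ hne
    rw [Pi.single_eq_of_ne hne, Rat.cast_zero, zero_mul]

theorem e_P_self {N γ : ℕ} (hγ : γ ∈ D.Δ N) (z : D.Z) :
    D.e γ (D.P N z) = D.cstar N (D.ext N) (codeAt (D.codes (N + 1)) γ)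
      (D.ext N N (z : D.Ambient)) := by
  rw [e_apply D hγ, val_P, ext_succ_self D.toData le_rfl]

/-- The last step of the evaluation analysis of an element of `Γ` of rank `N + 1`: for elements with
a weight `m_j`, either the age is `1`, or there is a predecessor `η`. -/
theorem evaluation {N γ : ℕ} (hγ : γ ∈ D.Δ N) :
    ((∀ i, 1 ≤ i → D.wt γ ≠ D.m i) ∧
      ∀ z C, (∀ l, ‖(D.val l z).1‖ ≤ C) → |D.e γ (D.P N z)| ≤ C) ∨
    ∃ (j p : ℕ) (B : D.Z →ₗ[ℝ] ℝ), 1 ≤ j ∧ j ≤ N + 1 ∧ D.wt γ = D.m j ∧ D.Dominated B ∧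
      ((D.ageOf γ = 1 ∧ ∀ z, D.e γ (D.P N z) = (D.m j : ℝ)⁻¹ * B (z - D.P p z)) ∨
        ∃ l η, l + 1 = p ∧ l < N ∧ η ∈ D.Δ l ∧ D.wt η = D.m j ∧ D.ageOf η < D.n j ∧
          D.ageOf γ = D.ageOf η + 1 ∧
          ∀ z, D.e γ (D.P N z) = D.e η z + (D.m j : ℝ)⁻¹ * B (z - D.P p z)) := by
  cases N with
  | zero =>
    obtain rfl : γ = 0 := by
      have := Finset.mem_Ico.mp hγ
      simp [Data.codes] at this
      omega
    left
    constructor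
    · intro i hi
      have := D.four_le hi
      rw [wt_eq D.toData hγ zero_lt_one]
      change 0 ≠ _
      omega
    · intro z C hC
      rw [e_P_self D hγ]
      change |(0 : ℝ)| ≤ C
      rw [abs_zero]
      exact (norm_nonneg _).trans (hC 0)
  | succ N =>
    have hnew := isNew_of_mem D.toData hγ
    have hwt := wt_eq D.toData hγ (Nat.lt_succ_self _)
    have hage := ageOf_eq D.toData hγ (Nat.lt_succ_self _)
    have he := e_P_self D hγ
    -- Unfolded once here, so that after generalizing the tuple each kind of tuple computes its own
    -- age.
    rw [age] at hage
    generalize codeAt (D.codes (N + 1 + 1)) γ = c at *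
    have hcont : ∀ {j p η : ℕ} {b : ℕ → ℚ} (_ : 1 ≤ j) (_ : j ≤ N + 2)
        (_ : ∑ γ ∈ Finset.range (D.codes (N + 1)).length, |b γ| ≤ 1)
        (_ : η < (D.codes (N + 1)).length) (_ : (codeAt (D.codes (N + 1)) η).rank = p)
        (_ : D.weight (codeAt (D.codes (N + 1)) η) = D.m j)
        (_ : age (D.codes (N + 1)) η < D.n j)
        (_ : c = .cont (N + 1 + 1) j p η b),
        ∃ (j p : ℕ) (B : D.Z →ₗ[ℝ] ℝ), 1 ≤ j ∧ j ≤ N + 2 ∧ D.wt γ = D.m j ∧ D.Dominated B ∧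
          ∃ l η, l + 1 = p ∧ l < N + 1 ∧ η ∈ D.Δ l ∧ D.wt η = D.m j ∧ D.ageOf η < D.n j ∧
            D.ageOf γ = D.ageOf η + 1 ∧
            ∀ z, D.e γ (D.P (N + 1) z) = D.e η z + (D.m j : ℝ)⁻¹ * B (z - D.P p z) := by
      rintro j p η b hj hjN hb hη hηp hw hageη rfl
      obtain ⟨l, hl, hηl⟩ := exists_mem_Δ D.toData hη
      have hlp : l + 1 = p := by rw [← hηp, rank_eq D.toData hl hηl]
      -- Elements of smaller rank have smaller labels, so the guard `η < γ` in the definition of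
      -- `age` holds.
      have hlt := lt_of_mem_Δ D.toData hl hγ hηl
      refine ⟨j, p, _, hj, hjN, hwt, dominated_comb D hb, l, η, hlp, hl, hηl, ?_, ?_, ?_, ?_⟩
      · rw [wt_eq D.toData hηl hl, hw]
      · rwa [ageOf_eq D.toData hηl hl]
      · rw [hage, ageOf_eq D.toData hηl (show l < N + 1 + 1 by omega)]
        simp [hlt]
      · intro z
        exact (he z).trans (congrArg₂ (· + ·) (pair_single_ext D hη z)
          (congrArg ((D.m j : ℝ)⁻¹ * ·) (pair_sub_ext D (N + 1) p b z)))
    have hstart : ∀ {j p : ℕ} {b : ℕ → ℚ} (_ : 1 ≤ j) (_ : j ≤ N + 2)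
        (_ : ∑ γ ∈ Finset.range (D.codes (N + 1)).length, |b γ| ≤ 1)
        (_ : c = .start (N + 1 + 1) j p b),
        ∃ (j p : ℕ) (B : D.Z →ₗ[ℝ] ℝ), 1 ≤ j ∧ j ≤ N + 2 ∧ D.wt γ = D.m j ∧ D.Dominated B ∧
          D.ageOf γ = 1 ∧
            ∀ z, D.e γ (D.P (N + 1) z) = (D.m j : ℝ)⁻¹ * B (z - D.P p z) := by
      rintro j p b hj hjN hb rfl
      refine ⟨j, p, _, hj, hjN, hwt, dominated_comb D hb, hage, fun z => ?_⟩
      exact (he z).trans (congrArg ((D.m j : ℝ)⁻¹ * ·) (pair_sub_ext D (N + 1) p b z))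
    cases hnew with
    | zero p f hp hf =>
      left
      constructor
      · intro i hi
        have := D.four_le hi
        rw [hwt]
        change 1 ≠ _
        omega
      · intro z C hC
        have hC0 : 0 ≤ C := (norm_nonneg _).trans (hC 0)
        have e : D.e γ (D.P (N + 1) z) = ∑ l ∈ Finset.range (N + 1), f l (D.val l z).1 := by
          rw [he]
          simp only [Data.cstar, LinearMap.sum_apply]
          refine Finset.sum_congr rfl fun l hl => ?_
          change f l (D.ext (N + 1) (N + 1) _ l).1 = _
          rw [ext_of_lt D.toData (Finset.mem_range.mp hl) (Finset.mem_range.mp hl)]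
          rfl
        rw [e]
        refine (Finset.abs_sum_le_sum_abs _ _).trans ((Finset.sum_le_sum fun l _ =>
          ((f l).le_opNorm _).trans (mul_le_mul_of_nonneg_left (hC l) (norm_nonneg _))).trans ?_)
        rw [← Finset.sum_mul]
        exact mul_le_of_le_one_left hC0 hf.2.2
    | evenStart j p b hj hjN hp hb =>
      obtain ⟨j, p, B, h1, h2, h3, h4, h5⟩ := hstart (by omega) hjN hb.2.2 rfl
      exact Or.inr ⟨j, p, B, h1, h2, h3, h4, Or.inl h5⟩
    | evenCont j p η b hj hjN hp hη hηp hw hη' hb =>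
      obtain ⟨j, p, B, h1, h2, h3, h4, h5⟩ := hcont (by omega) hjN hb.2.2 hη hηp hw hη' rfl
      exact Or.inr ⟨j, p, B, h1, h2, h3, h4, Or.inr h5⟩
    | oddStart j i η hj hjN hη hi hw hbig =>
      obtain ⟨j, p, B, h1, h2, h3, h4, h5⟩ :=
        hstart (p := 0) (by omega) (by omega) (sum_single_le _ _) rfl
      exact Or.inr ⟨j, p, B, h1, h2, h3, h4, Or.inl h5⟩
    | oddCont j p η ξ hj hjN hη hηp hw hη' hξ hpξ hwξ =>
      obtain ⟨j, p, B, h1, h2, h3, h4, h5⟩ :=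
        hcont (by omega) (by omega) (sum_single_le _ _) hη hηp hw hη' rfl
      exact Or.inr ⟨j, p, B, h1, h2, h3, h4, Or.inr h5⟩

/-- A predecessor has age below n_i. The extra 1 covers elements of age 1 without any lower bound on
n_i. -/
theorem ageOf_le {N γ i : ℕ} (hγ : γ ∈ D.Δ N) (hi : 1 ≤ i) (hw : D.wt γ = D.m i) :
    D.ageOf γ ≤ D.n i + 1 := by
  rcases evaluation D hγ with h | ⟨j, p, B, hj, -, hwj, -, h | ⟨l, η, -, -, -, -, h1, h2, -⟩⟩
  · exact absurd hw (h.1 i hi)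
  · omega
  · obtain rfl := D.m_inj hi hj (hw ▸ hwj)
    omega

end evaluation

end AHSum

namespace AHSum

/-- The intervals [p_k, q_k) are disjoint, so N lies in at most one of them and at most one summand
survives. -/
theorem norm_sum_le_of_straddle {V : Type*} [SeminormedAddCommGroup V] {p q : ℕ → ℕ}
    (hpq : ∀ k l, k < l → q k ≤ p l) {A : Finset ℕ} (N : ℕ) {g : ℕ → V} {C : ℝ} (hC : 0 ≤ C)
    (h0 : ∀ k ∈ A, ¬ (p k ≤ N ∧ N < q k) → g k = 0) (h1 : ∀ k ∈ A, ‖g k‖ ≤ C) :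
    ‖∑ k ∈ A, g k‖ ≤ C := by
  by_cases h : ∃ k ∈ A, p k ≤ N ∧ N < q k
  · obtain ⟨k, hk, hkN⟩ := h
    rw [Finset.sum_eq_single_of_mem k hk]
    · exact h1 k hk
    · intro l hl hlk
      refine h0 l hl fun hlN => ?_
      rcases lt_or_gt_of_ne hlk with h | h
      · have := hpq l k h
        omega
      · have := hpq k l h
        omega
  · push Not at h
    rw [Finset.sum_eq_zero fun k hk => h0 k hk fun hkN => absurd hkN.2 (not_lt.mpr (h k hk hkN.1)),
      norm_zero]
    exact hC

variable {X : ℕ → Type u} [∀ k, NormedAddCommGroup (X k)] [∀ k, NormedSpace ℝ (X k)]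

/-! ### Coordinates of sums of block vectors -/

section estimates

variable (D : Parameters X)

theorem e_P_of_lt {l n γ : ℕ} (hγ : γ ∈ D.Δ l) (h : l < n) (z : D.Z) :
    D.e γ (D.P n z) = D.e γ z := by
  rw [e_apply D hγ, e_apply D hγ, val_P_of_lt D h]

theorem val_eq_zero_of_lt {l n : ℕ} (h : l < n) {z : D.Z} (hz : D.P n z = 0) :
    D.val l z = 0 := by
  rw [← val_P_of_lt D h, hz, map_zero]

theorem e_eq_zero_of_lt {l n γ : ℕ} (hγ : γ ∈ D.Δ l) (h : l < n) {z : D.Z} (hz : D.P n z = 0) :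
    D.e γ z = 0 := by
  rw [← e_P_of_lt D hγ h, hz, map_zero]

/-- The vectors `z k` are supported on the successive intervals `(p k, q k]`. -/
def Parameters.BlockOn (p q : ℕ → ℕ) (z : ℕ → D.Z) : Prop :=
  ∀ k, p k < q k ∧ q k ≤ p (k + 1) ∧ z k ∈ D.segment (p k) (q k)

variable {D}
variable {p q : ℕ → ℕ} {z : ℕ → D.Z} {C : ℝ}

theorem Parameters.BlockOn.strictMono (hz : D.BlockOn p q z) : StrictMono p :=
  strictMono_nat_of_lt_succ fun k => (hz k).1.trans_le (hz k).2.1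

theorem Parameters.BlockOn.le (hz : D.BlockOn p q z) (k l : ℕ) (h : k < l) : q k ≤ p l :=
  (hz k).2.1.trans (hz.strictMono.monotone h)

theorem Parameters.BlockOn.P_eq_zero (hz : D.BlockOn p q z) {k n : ℕ} (h : n ≤ p k) :
    D.P n (z k) = 0 :=
  (P_of_mem_segment D (hz k).2.2).1 n h

theorem Parameters.BlockOn.P_eq_self (hz : D.BlockOn p q z) {k n : ℕ} (h : q k ≤ n) :
    D.P n (z k) = z k :=
  (P_of_mem_segment D (hz k).2.2).2 n h

/-- The part of `e_γ*` which does not come from `c_γ*` meets only one of the vectors. -/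
theorem Parameters.BlockOn.abs_e_sub_P_le (hz : D.BlockOn p q z) (hC : ∀ k, ‖z k‖ ≤ C)
    {N γ : ℕ} (hγ : γ ∈ D.Δ N) (A : Finset ℕ) :
    |D.e γ (∑ k ∈ A, z k) - D.e γ (D.P N (∑ k ∈ A, z k))| ≤ 3 * C := by
  have hC0 : 0 ≤ C := (norm_nonneg _).trans (hC 0)
  rw [map_sum, map_sum, map_sum, ← Finset.sum_sub_distrib, ← Real.norm_eq_abs]
  -- If p_k > N, both terms vanish at z_k, since γ has rank N + 1. If q_k ≤ N, they agree because
  -- P_{[1,N]} fixes z_k.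
  refine norm_sum_le_of_straddle hz.le N (by positivity) (fun k _ hk => ?_) fun k _ => ?_
  · rcases not_and_or.mp hk with h | h
    · rw [hz.P_eq_zero (by omega), map_zero, sub_zero]
      exact e_eq_zero_of_lt D hγ (Nat.lt_succ_self N) (hz.P_eq_zero (by omega))
    · rw [hz.P_eq_self (by omega), sub_self]
  · rw [← map_sub, Real.norm_eq_abs]
    linarith [abs_e_le D γ (z k - D.P N (z k)), norm_sub_P_le D N (z k), hC k]

/-- A vector starting after l vanishes at l, and one ending before l was continued by zero in X_l.
Only the vector whose range meets l contributes. -/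
theorem Parameters.BlockOn.norm_fst_le (hz : D.BlockOn p q z) (hC : ∀ k, ‖z k‖ ≤ C)
    (A : Finset ℕ) (l : ℕ) : ‖(D.val l (∑ k ∈ A, z k)).1‖ ≤ C := by
  have hC0 : 0 ≤ C := (norm_nonneg _).trans (hC 0)
  rw [map_sum, Prod.fst_sum]
  refine norm_sum_le_of_straddle hz.le l hC0 (fun k _ hk => ?_) fun k _ => ?_
  · rcases not_and_or.mp hk with h | h
    · rw [val_eq_zero_of_lt D (not_le.mp h) (hz.P_eq_zero le_rfl)]
      rfl
    · rw [← hz.P_eq_self le_rfl]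
      exact fst_val_P D (not_lt.mp h) _
  · exact (_root_.norm_fst_le _).trans ((norm_val_le D l _).trans (hC k))

/-- Coordinates without a weight `m_j`. -/
theorem Parameters.BlockOn.abs_e_le_of_unweighted (hz : D.BlockOn p q z) (hC : ∀ k, ‖z k‖ ≤ C)
    {N γ : ℕ} (hγ : γ ∈ D.Δ N) (hw : ∀ i, 1 ≤ i → D.wt γ ≠ D.m i) (A : Finset ℕ) :
    |D.e γ (∑ k ∈ A, z k)| ≤ 4 * C := by
  have h1 := hz.abs_e_sub_P_le hC hγ A
  rcases evaluation D hγ with ⟨-, h⟩ | ⟨j, -, -, hj, -, hwj, -⟩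
  · have h2 := h _ C (hz.norm_fst_le hC A)
    rw [abs_le] at *
    constructor <;> linarith
  · exact absurd hwj (hw j hj)

/-- The operator I - P_{[1,n]} fixes the vectors with n ≤ p_k and kills those with q_k ≤ n. At most
one vector remains, and it costs 3C. Counting only the indices with n ≤ p_k is what lets the
contributions along an evaluation analysis add up to |A|. -/
theorem Dominated.abs_sub_P_le (hz : D.BlockOn p q z) (hC : ∀ k, ‖z k‖ ≤ C) {θ M : ℝ}
    (h : ∀ γ (A : Finset ℕ), |D.e γ (∑ k ∈ A, z k)| ≤ θ * A.card + M)
    {B : D.Z →ₗ[ℝ] ℝ} (hB : D.Dominated B) (n : ℕ) (A : Finset ℕ) :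
    |B (∑ k ∈ A, z k - D.P n (∑ k ∈ A, z k))| ≤
      θ * ({k ∈ A | n ≤ p k} : Finset ℕ).card + M + 3 * C := by
  have hC0 : 0 ≤ C := (norm_nonneg _).trans (hC 0)
  have e : ∑ k ∈ A, z k - D.P n (∑ k ∈ A, z k) =
      ∑ k ∈ A with n ≤ p k, z k + ∑ k ∈ A with ¬ n ≤ p k, (z k - D.P n (z k)) := by
    rw [map_sum, ← Finset.sum_sub_distrib, ← Finset.sum_filter_add_sum_filter_not A (n ≤ p ·)]
    congr 1
    refine Finset.sum_congr rfl fun k hk => ?_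
    rw [hz.P_eq_zero (Finset.mem_filter.mp hk).2, sub_zero]
  rw [e, map_add]
  refine (abs_add_le _ _).trans (add_le_add (hB _ _ fun γ => h γ _) ?_)
  refine (hB.abs_le _).trans ?_
  refine norm_sum_le_of_straddle hz.le n (by positivity) (fun k hk hkn => ?_) fun k _ => ?_
  · have := (Finset.mem_filter.mp hk).2
    rw [hz.P_eq_self (by omega), sub_self]
  · linarith [norm_sub_P_le D n (z k), hC k]

/-- Sums of block sequences: a coordinate of weight `m_i` gains the factor `1 / m_i`, up to an error
proportional to its age. -/
theorem Parameters.BlockOn.abs_e_le_of_weight (hz : D.BlockOn p q z) (hC : ∀ k, ‖z k‖ ≤ C)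
    {θ M : ℝ} (hθ : 0 ≤ θ) (hM : 0 ≤ M)
    (h : ∀ γ (A : Finset ℕ), |D.e γ (∑ k ∈ A, z k)| ≤ θ * A.card + M)
    {i : ℕ} (hi : 1 ≤ i) {N γ : ℕ} (hγ : γ ∈ D.Δ N) (hw : D.wt γ = D.m i) (A : Finset ℕ) :
    |D.e γ (∑ k ∈ A, z k)| ≤ D.ageOf γ * (6 * C + M) + θ / D.m i * A.card := by
  have hC0 : 0 ≤ C := (norm_nonneg _).trans (hC 0)
  have hm : (4 : ℝ) ≤ D.m i := by exact_mod_cast D.four_le hi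
  induction γ using Nat.strong_induction_on generalizing N A with
  | _ γ ih =>
  have h1 := abs_le.mp (hz.abs_e_sub_P_le hC hγ A)
  have hB : ∀ {B : D.Z →ₗ[ℝ] ℝ} (_ : D.Dominated B) (n : ℕ),
      |(D.m i : ℝ)⁻¹ * B (∑ k ∈ A, z k - D.P n (∑ k ∈ A, z k))| ≤
        θ / D.m i * ({k ∈ A | n ≤ p k} : Finset ℕ).card + (M + 3 * C) := by
    intro B hB n
    have h2 := Dominated.abs_sub_P_le hz hC h hB n A
    -- The factor 1/m_i is needed only on the term in θ; the constants are bounded using 1/m_i ≤ 1.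
    have hinv : (D.m i : ℝ)⁻¹ ≤ 1 := inv_le_one_of_one_le₀ (by linarith)
    have hinv0 : 0 ≤ (D.m i : ℝ)⁻¹ := by positivity
    rw [abs_mul, abs_of_nonneg hinv0]
    refine (mul_le_mul_of_nonneg_left h2 hinv0).trans ?_
    rw [div_eq_mul_inv]
    nlinarith
  rcases evaluation D hγ with hu | ⟨j, n, B, hj, -, hwj, hBd, hev⟩
  · exact absurd hw (hu.1 i hi)
  obtain rfl := D.m_inj hi hj (hw ▸ hwj)
  have h2 := abs_le.mp (hB hBd n)
  have hθm : 0 ≤ θ / D.m i := by positivity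
  rcases hev with ⟨hage, hev⟩ | ⟨l, η, rfl, hl, hη, hwη, -, hage, hev⟩
  · have hcard : (({k ∈ A | n ≤ p k} : Finset ℕ).card : ℝ) ≤ A.card := by
      exact_mod_cast Finset.card_filter_le _ _
    have := mul_le_mul_of_nonneg_left hcard hθm
    rw [hev] at h1
    rw [hage, Nat.cast_one, abs_le]
    constructor <;> linarith
  · have hcard : (({k ∈ A | l + 1 ≤ p k} : Finset ℕ).card : ℝ) +
        ({k ∈ A | ¬ l + 1 ≤ p k} : Finset ℕ).card = A.card := by
      exact_mod_cast Finset.card_filter_add_card_filter_not _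
    -- The predecessor η has rank l + 1, so it sees only vectors with p_k ≤ l, and B has been
    -- charged for the others. Each step of the analysis adds 3C + (M + 3C).
    have h3 := ih η (lt_of_mem_Δ D.toData hl hγ hη) hη hwη {k ∈ A | ¬ l + 1 ≤ p k}
    have e : D.e η (∑ k ∈ A, z k) = D.e η (∑ k ∈ A with ¬ l + 1 ≤ p k, z k) := by
      rw [← Finset.sum_filter_add_sum_filter_not A (l + 1 ≤ p ·), map_add, map_sum,
        Finset.sum_eq_zero, zero_add]
      intro k hk
      exact e_eq_zero_of_lt D hη (Finset.mem_filter.mp hk).2 (hz.P_eq_zero le_rfl)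
    rw [hev, e] at h1
    have h4 := abs_le.mp h3
    rw [hage, abs_le, ← hcard]
    push_cast
    constructor <;> linarith

/-- Weight m_i occurs only in ranks at least i > n, where v is already extended. Each B-term with a
predecessor η then vanishes, so e_γ*(v) equals e_η*(v). Descending to age 1 leaves a single term
m_i⁻¹ B(v - P v). -/
theorem abs_e_le_of_P_eq_self {n i N γ : ℕ} {v : D.Z} (hv : D.P n v = v) (hi : 1 ≤ i)
    (hni : n < i) (hγ : γ ∈ D.Δ N) (hw : D.wt γ = D.m i) :
    |D.e γ v| ≤ 3 * ‖v‖ / D.m i := by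
  have hm : (4 : ℝ) ≤ D.m i := by exact_mod_cast D.four_le hi
  induction γ using Nat.strong_induction_on generalizing N with
  | _ γ ih =>
  rcases evaluation D hγ with hu | ⟨j, r, B, hj, hjN, hwj, hBd, hev⟩
  · exact absurd hw (hu.1 i hi)
  obtain rfl := D.m_inj hi hj (hw ▸ hwj)
  have hself : ∀ m, n ≤ m → D.P m v = v := fun m hm => by rw [← hv, P_P_of_ge D hm]
  rcases hev with ⟨-, hev⟩ | ⟨l, η, rfl, hl, hη, hwη, -, -, hev⟩
  · rw [← hself N (by omega), hev, hself N (by omega), abs_mul, abs_inv,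
      abs_of_pos (by linarith : (0 : ℝ) < D.m i), inv_mul_eq_div]
    gcongr
    exact (hBd.abs_le _).trans (norm_sub_P_le D r v)
  · have hil : i ≤ l + 1 := by
      rcases evaluation D hη with hu | ⟨j, -, -, hj, hjl, hwj', -⟩
      · exact absurd hwη (hu.1 i hi)
      · obtain rfl := D.m_inj hi hj (hwη ▸ hwj')
        exact hjl
    have := hev v
    rw [hself N (by omega), hself (l + 1) (by omega), sub_self, map_zero, mul_zero,
      add_zero] at this
    rw [this]
    exact ih η (lt_of_mem_Δ D.toData hl hγ hη) hη hwη

end estimates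

end AHSum

namespace AHSum

/-! ### Weak nullity of RIS and of bounded block sequences -/

theorem tendsto_zero_of_sum_le {W : Type u} [NormedAddCommGroup W] [NormedSpace ℝ W] {z : ℕ → W}
    (h : ∀ ε > 0, ∃ M : ℝ, ∀ A : Finset ℕ, ‖∑ k ∈ A, z k‖ ≤ ε * A.card + M)
    (f : StrongDual ℝ W) {δ : ℝ} (hδ : 0 < δ) : {k | δ ≤ f (z k)}.Finite := by
  by_contra hinf
  have hf : 0 < ‖f‖ + 1 := by positivity
  -- This ε makes the linear term at most half of nδ; n is then chosen so that the constant term is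
  -- less than the other half. Using ‖f‖ + 1 avoids division by zero.
  obtain ⟨M, hM⟩ := h (δ / (2 * (‖f‖ + 1))) (by positivity)
  obtain ⟨n, hn⟩ := exists_nat_gt (2 * ((‖f‖ + 1) * M) / δ)
  obtain ⟨A, hA, hcard⟩ := Set.Infinite.exists_subset_card_eq hinf n
  have h1 : (n : ℝ) * δ ≤ f (∑ k ∈ A, z k) := by
    rw [map_sum, ← hcard, ← nsmul_eq_mul]
    exact Finset.card_nsmul_le_sum _ _ _ fun k hk => hA hk
  have h2 : f (∑ k ∈ A, z k) ≤ (‖f‖ + 1) * (δ / (2 * (‖f‖ + 1)) * n + M) := by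
    refine (le_abs_self _).trans ((f.le_opNorm _).trans ?_)
    have := hM A
    rw [hcard] at this
    exact mul_le_mul (by linarith) this (norm_nonneg _) hf.le
  have h3 : (‖f‖ + 1) * (δ / (2 * (‖f‖ + 1)) * n + M) = δ * n / 2 + (‖f‖ + 1) * M := by
    field_simp
  rw [div_lt_iff₀ hδ] at hn
  linarith

theorem weaklyNull_of_finite {W : Type u} [NormedAddCommGroup W] [NormedSpace ℝ W] {z : ℕ → W}
    (h : ∀ (f : StrongDual ℝ W) (δ : ℝ), 0 < δ → {k | δ ≤ f (z k)}.Finite) : WeaklyNull z := by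
  intro f
  rw [Metric.tendsto_atTop]
  intro δ hδ
  obtain ⟨N, hN⟩ := ((h f δ hδ).union (h (-f) δ hδ)).bddAbove
  refine ⟨N + 1, fun n hn => ?_⟩
  by_contra hcon
  rw [dist_zero_right, Real.norm_eq_abs, not_lt] at hcon
  have : n ≤ N := hN (by
    rcases le_abs.mp hcon with h | h
    · exact Or.inl h
    · exact Or.inr h)
  omega

variable {X : ℕ → Type u} [∀ k, NormedAddCommGroup (X k)] [∀ k, NormedSpace ℝ (X k)]
variable {D : Parameters X} {p q : ℕ → ℕ} {z : ℕ → D.Z} {C : ℝ}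

theorem mem_range_wt_or (D : Parameters X) (γ : ℕ) :
    (∃ i, 1 ≤ i ∧ D.wt γ = D.m i) ∨ ∀ i, 1 ≤ i → D.wt γ ≠ D.m i := by
  by_contra! h
  obtain ⟨h1, i, hi, h2⟩ := h
  exact h1 i hi h2

/-- Sums of a RIS: coordinates of weight `m_i`. -/
theorem Parameters.BlockOn.abs_e_le_of_ris (hz : D.BlockOn p q z) (hC : ∀ k, ‖z k‖ ≤ C)
    {j : ℕ → ℕ} (hj : StrictMono j) (hran : ∀ k, D.maxRan (z k) < j (k + 1))
    {i N γ : ℕ} (hi : 1 ≤ i) (hγ : γ ∈ D.Δ N) (hw : D.wt γ = D.m i)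
    (hsmall : ∀ k, i < j k → |D.e γ (z k)| ≤ C / D.m i) (A : Finset ℕ) :
    |D.e γ (∑ k ∈ A, z k)| ≤ 3 * C / D.m i * A.card + C := by
  have hC0 : 0 ≤ C := (norm_nonneg _).trans (hC 0)
  have hm : (4 : ℝ) ≤ D.m i := by exact_mod_cast D.four_le hi
  -- If i < j_k, the RIS condition applies. If j_{k+1} ≤ i, the range of z_k ends before i and
  -- `abs_e_le_of_P_eq_self` applies. At most one k has j_k ≤ i < j_{k+1}, and it contributes at
  -- most C.
  rw [map_sum, ← Finset.sum_filter_add_sum_filter_not A (fun k => i < j k ∨ j (k + 1) ≤ i)]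
  refine (abs_add_le _ _).trans (add_le_add ?_ ?_)
  · calc |∑ k ∈ A with (i < j k ∨ j (k + 1) ≤ i), D.e γ (z k)|
        ≤ ∑ k ∈ A with (i < j k ∨ j (k + 1) ≤ i), 3 * C / D.m i := by
          refine (Finset.abs_sum_le_sum_abs _ _).trans (Finset.sum_le_sum fun k hk => ?_)
          rcases (Finset.mem_filter.mp hk).2 with h | h
          · refine (hsmall k h).trans ?_
            gcongr
            linarith
          · refine (abs_e_le_of_P_eq_self (P_maxRan D (hz k).2.2 le_rfl) hi
              ((hran k).trans_le h) hγ hw).trans ?_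
            gcongr
            exact hC k
      _ ≤ 3 * C / D.m i * A.card := by
          rw [Finset.sum_const, nsmul_eq_mul, mul_comm]
          gcongr
          exact Finset.filter_subset _ _
  · rw [← Real.norm_eq_abs]
    refine norm_sum_le_of_straddle (p := j) (q := fun k => j (k + 1))
      (fun k l h => hj.monotone h) i hC0 (fun k hk hki => ?_) fun k _ => ?_
    · have := (Finset.mem_filter.mp hk).2
      omega
    · exact (abs_e_le D γ _).trans (hC k)

/-- Sums of a RIS, one step of the improvement of the coefficient. -/
theorem ris_step (hz : D.BlockOn p q z) (hC : ∀ k, ‖z k‖ ≤ C)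
    (hris : ∀ (i N γ : ℕ) (A : Finset ℕ), 1 ≤ i → γ ∈ D.Δ N → D.wt γ = D.m i →
      |D.e γ (∑ k ∈ A, z k)| ≤ 3 * C / D.m i * A.card + C)
    {θ M ε : ℝ} (hθ : 0 ≤ θ) (hM : 0 ≤ M) (hε : 0 < ε)
    (h : ∀ γ (A : Finset ℕ), |D.e γ (∑ k ∈ A, z k)| ≤ θ * A.card + M) :
    ∃ M' : ℝ, 0 ≤ M' ∧
      ∀ γ (A : Finset ℕ), |D.e γ (∑ k ∈ A, z k)| ≤ max (θ / 4) ε * A.card + M' := by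
  have hC0 : 0 ≤ C := (norm_nonneg _).trans (hC 0)
  -- From i₀ on, m_i ≥ i makes the RIS coefficient 3C/m_i less than ε. The finitely many smaller
  -- weights have ages bounded by a common a.
  obtain ⟨i₀, hi₀⟩ := exists_nat_gt (3 * C / ε)
  set a : ℝ := ((∑ i ∈ Finset.range i₀, (D.n i + 1) : ℕ) : ℝ) with ha
  have ha0 : 0 ≤ a := Nat.cast_nonneg _
  have haM : 0 ≤ a * (6 * C + M) := by positivity
  refine ⟨a * (6 * C + M) + 4 * C, by positivity, fun γ A => ?_⟩
  have hcard : (0 : ℝ) ≤ A.card := Nat.cast_nonneg _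
  have hmax : 0 ≤ max (θ / 4) ε * A.card :=
    mul_nonneg (hε.le.trans (le_max_right _ _)) hcard
  by_cases hγ : ∃ N, γ ∈ D.Δ N
  swap
  · have : D.e γ (∑ k ∈ A, z k) = 0 := coord_of_notMem D.toData hγ _
    rw [this, abs_zero]
    positivity
  obtain ⟨N, hγ⟩ := hγ
  rcases mem_range_wt_or D γ with ⟨i, hi, hw⟩ | hw
  swap
  · linarith [hz.abs_e_le_of_unweighted hC hγ hw A]
  have hm : (4 : ℝ) ≤ D.m i := by exact_mod_cast D.four_le hi
  rcases lt_or_ge i i₀ with hlt | hge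
  · have hage : (D.ageOf γ : ℝ) ≤ a := by
      rw [ha]
      exact_mod_cast (ageOf_le D hγ hi hw).trans
        (Finset.single_le_sum (f := fun i => D.n i + 1) (fun _ _ => Nat.zero_le _)
          (Finset.mem_range.mpr hlt))
    refine (hz.abs_e_le_of_weight hC hθ hM h hi hγ hw A).trans ?_
    have h1 : θ / D.m i ≤ max (θ / 4) ε :=
      (div_le_div_of_nonneg_left hθ (by norm_num) hm).trans (le_max_left _ _)
    have h2 := mul_le_mul_of_nonneg_right h1 hcard
    have h3 := mul_le_mul_of_nonneg_right hage (by positivity : 0 ≤ 6 * C + M)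
    linarith
  · have h1 : 3 * C / D.m i ≤ max (θ / 4) ε := by
      refine le_trans ?_ (le_max_right _ _)
      rw [div_le_iff₀ (by linarith)]
      rw [div_lt_iff₀ hε] at hi₀
      have : (i₀ : ℝ) ≤ D.m i := by exact_mod_cast hge.trans (D.le_m hi)
      nlinarith
    have h2 := mul_le_mul_of_nonneg_right h1 hcard
    linarith [hris i N γ A hi hγ hw]

/-- The triangle inequality gives the coefficient C to start with. Each use of `ris_step` divides it
by 4 until ε is reached, while M grows but stays independent of γ and A. -/
theorem ris_coordinates (hz : D.BlockOn p q z) (hC : ∀ k, ‖z k‖ ≤ C)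
    (hris : ∀ (i N γ : ℕ) (A : Finset ℕ), 1 ≤ i → γ ∈ D.Δ N → D.wt γ = D.m i →
      |D.e γ (∑ k ∈ A, z k)| ≤ 3 * C / D.m i * A.card + C) {ε : ℝ} (hε : 0 < ε) :
    ∃ M : ℝ, 0 ≤ M ∧ ∀ γ (A : Finset ℕ), |D.e γ (∑ k ∈ A, z k)| ≤ ε * A.card + M := by
  have hC0 : 0 ≤ C := (norm_nonneg _).trans (hC 0)
  have key : ∀ t : ℕ, ∃ M : ℝ, 0 ≤ M ∧
      ∀ γ (A : Finset ℕ), |D.e γ (∑ k ∈ A, z k)| ≤ max (C * (1 / 4) ^ t) ε * A.card + M := by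
    intro t
    induction t with
    | zero =>
      refine ⟨0, le_rfl, fun γ A => ?_⟩
      rw [pow_zero, mul_one, add_zero]
      refine (abs_e_le D γ _).trans ((norm_sum_le_of_le A fun k _ => hC k).trans ?_)
      rw [Finset.sum_const, nsmul_eq_mul, mul_comm]
      gcongr
      exact le_max_left _ _
    | succ t ih =>
      obtain ⟨M, hM, h⟩ := ih
      obtain ⟨M', hM', h'⟩ := ris_step hz hC hris (by positivity) hM hε h
      refine ⟨M', hM', fun γ A => (h' γ A).trans ?_⟩
      refine add_le_add (mul_le_mul_of_nonneg_right ?_ (Nat.cast_nonneg _)) le_rfl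
      refine max_le ?_ (le_max_right _ _)
      rcases le_total (C * (1 / 4) ^ t) ε with h | h
      · rw [max_eq_right h]
        exact (by linarith : ε / 4 ≤ ε).trans (le_max_right _ _)
      · rw [max_eq_left h, pow_succ]
        exact (le_of_eq (by ring)).trans (le_max_left _ _)
  obtain ⟨t, ht⟩ := exists_pow_lt_of_lt_one (show 0 < ε / (C + 1) by positivity)
    (show (1 / 4 : ℝ) < 1 by norm_num)
  obtain ⟨M, hM, h⟩ := key t
  refine ⟨M, hM, fun γ A => ?_⟩
  have : max (C * (1 / 4) ^ t) ε = ε := by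
    refine max_eq_right ?_
    rw [lt_div_iff₀ (by positivity)] at ht
    have : (0 : ℝ) < (1 / 4) ^ t := by positivity
    nlinarith
  rw [← this]
  exact h γ A

theorem weaklyNull_of_isRIS (h : D.IsRIS z) : WeaklyNull z := by
  obtain ⟨C, hC0, ⟨p, q, hz⟩, j, hj, hC, hran, hsmall⟩ := h
  replace hz : D.BlockOn p q z := hz
  have hris : ∀ (i N γ : ℕ) (A : Finset ℕ), 1 ≤ i → γ ∈ D.Δ N → D.wt γ = D.m i →
      |D.e γ (∑ k ∈ A, z k)| ≤ 3 * C / D.m i * A.card + C := by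
    intro i N γ A hi hγ hw
    refine hz.abs_e_le_of_ris hC hj hran hi hγ hw (fun k hk => ?_) A
    rw [e_apply D hγ]
    refine hsmall k N ⟨γ, hγ⟩ i hi hk ?_
    rw [← hw, wt_eq D.toData hγ (Nat.lt_succ_self N)]
  refine weaklyNull_of_finite fun f δ hδ => tendsto_zero_of_sum_le (fun ε hε => ?_) f hδ
  obtain ⟨M, hM, h⟩ := ris_coordinates hz hC hris hε
  refine ⟨M + C, fun A => norm_le_of_coordinates D _ (fun l => ?_) fun γ => ?_⟩
  · have := hz.norm_fst_le hC A l
    have : 0 ≤ ε * A.card := by positivity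
    linarith
  · linarith [h γ A]

/-- Long averages of a bounded block sequence. -/
theorem Parameters.BlockOn.abs_e_average_le (hz : D.BlockOn p q z) (hC : ∀ k, ‖z k‖ ≤ C)
    {i N γ : ℕ} (hi : 1 ≤ i) (hγ : γ ∈ D.Δ N) (hw : D.wt γ = D.m i) {A : Finset ℕ}
    (hA : (D.n i + 1) * D.m i ≤ A.card) :
    |D.e γ ((A.card : ℝ)⁻¹ • ∑ k ∈ A, z k)| ≤ 7 * C / D.m i := by
  have hC0 : 0 ≤ C := (norm_nonneg _).trans (hC 0)
  have hm : (4 : ℝ) ≤ D.m i := by exact_mod_cast D.four_le hi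
  have hA' : ((D.n i : ℝ) + 1) * D.m i ≤ A.card := by exact_mod_cast hA
  have hn : (0 : ℝ) ≤ D.n i := Nat.cast_nonneg _
  have hcard : (0 : ℝ) < A.card := by nlinarith
  -- The triangle inequality is the input here, with θ = C and M = 0. Since the age is at most
  -- |A|/m_i, the error 6C·age joins C|A|/m_i to give 7C|A|/m_i.
  have h := hz.abs_e_le_of_weight hC hC0 le_rfl (fun γ A => by
    rw [add_zero, mul_comm, ← nsmul_eq_mul, ← Finset.sum_const]
    exact (abs_e_le D γ _).trans (norm_sum_le_of_le A fun k _ => hC k)) hi hγ hw A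
  have hage : (D.ageOf γ : ℝ) ≤ D.n i + 1 := by exact_mod_cast ageOf_le D hγ hi hw
  rw [map_smul, smul_eq_mul, abs_mul, abs_inv, abs_of_pos hcard, inv_mul_le_iff₀ hcard]
  refine h.trans ?_
  have h1 : (D.ageOf γ : ℝ) ≤ A.card / D.m i := by
    rw [le_div_iff₀ (by linarith)]
    nlinarith
  have h2 := mul_le_mul_of_nonneg_right h1 (by positivity : 0 ≤ 6 * C)
  rw [add_zero]
  refine (add_le_add_left h2 _).trans (le_of_eq ?_)
  ring

/-- Averaging preserves the lower bound f ≥ δ, and a long enough average has small coordinates for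
any prescribed finite set of weights. Successive averages thus form a RIS on which f does not tend
to zero. -/
theorem weaklyNull_of_isBlock (h : D.IsBlock z) (hb : ∃ C : ℝ, ∀ k, ‖z k‖ ≤ C) :
    WeaklyNull z := by
  obtain ⟨p, q, hz⟩ := h
  replace hz : D.BlockOn p q z := hz
  obtain ⟨C, hC⟩ : ∃ C : ℝ, ∀ k, ‖z k‖ ≤ C := hb
  have hC0 : 0 ≤ C := (norm_nonneg _).trans (hC 0)
  refine weaklyNull_of_finite fun f δ hδ => ?_
  by_contra hinf
  have hsets : ∀ b : ℕ, ∃ A : Finset ℕ, (∀ k ∈ A, b ≤ k ∧ δ ≤ f (z k)) ∧ 0 < A.card ∧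
      ∀ i < p b + 1, (D.n i + 1) * D.m i ≤ A.card := by
    intro b
    have hinf' : ({k | δ ≤ f (z k)} \ Set.Iio b).Infinite :=
      Set.Infinite.sdiff hinf (Set.finite_Iio b)
    obtain ⟨A, hA, hcard⟩ := hinf'.exists_subset_card_eq
      -- The sum dominates each length required for the weights with i < p_b + 1, and the final 1
      -- makes A nonempty.
      (∑ i ∈ Finset.range (p b + 1), (D.n i + 1) * D.m i + 1)
    refine ⟨A, fun k hk => ⟨not_lt.mp (hA hk).2, (hA hk).1⟩, by omega, fun i hi => ?_⟩
    have := Finset.single_le_sum (f := fun i => (D.n i + 1) * D.m i) (fun _ _ => Nat.zero_le _)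
      (Finset.mem_range.mpr hi)
    rw [hcard]
    exact this.trans (Nat.le_succ _)
  choose A hA hpos hbig using hsets
  -- Each new set of indices starts just beyond the previous one, so the averages are again block.
  let b : ℕ → ℕ := fun k => Nat.rec 0 (fun _ c => (A c).sup id + 1) k
  have hb1 : ∀ k, ∀ l ∈ A (b k), l < b (k + 1) := fun k l hl =>
    Nat.lt_succ_of_le (Finset.le_sup (f := id) hl)
  have hb2 : StrictMono b := strictMono_nat_of_lt_succ fun k => by
    obtain ⟨l, hl⟩ := Finset.card_pos.mp (hpos (b k))
    exact (hA _ l hl).1.trans_lt (hb1 k l hl)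
  let y : ℕ → D.Z := fun k => ((A (b k)).card : ℝ)⁻¹ • ∑ l ∈ A (b k), z l
  have hcard : ∀ k, (0 : ℝ) < (A (b k)).card := fun k => by exact_mod_cast hpos (b k)
  have hyC : ∀ k, ‖y k‖ ≤ C := fun k => by
    rw [norm_smul, norm_inv, Real.norm_eq_abs, abs_of_pos (hcard k), inv_mul_le_iff₀ (hcard k),
      ← nsmul_eq_mul, ← Finset.sum_const]
    exact norm_sum_le_of_le _ fun k _ => hC k
  have hyseg : ∀ k, y k ∈ D.segment (p (b k)) (p (b (k + 1))) := fun k =>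
    Submodule.smul_mem _ _ (Submodule.sum_mem _ fun l hl =>
      segment_mono D (hz.strictMono.monotone (hA _ l hl).1) (hz.le l _ (hb1 k l hl)) (hz l).2.2)
  have hris : D.IsRIS y := by
    -- C + 1 keeps the RIS constant positive when C = 0. The indices j_k = p_{b_k} + 1 exceed the
    -- end of the preceding average, and the length of the k-th average was chosen for all i < j_k.
    refine ⟨7 * (C + 1), by positivity, ⟨fun k => p (b k), fun k => p (b (k + 1)), fun k =>
      ⟨hz.strictMono (hb2 (Nat.lt_succ_self k)), le_rfl, hyseg k⟩⟩, fun k => p (b k) + 1,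
      fun k l hkl => Nat.succ_lt_succ (hz.strictMono (hb2 hkl)),
      fun k => by linarith [hyC k], fun k => Nat.lt_succ_of_le (maxRan_le D (hyseg k)),
      fun k l γ i hi hik hw => ?_⟩
    rw [← wt_eq D.toData γ.2 (Nat.lt_succ_self l)] at hw
    have := hz.abs_e_average_le hC hi γ.2 hw (hbig (b k) i hik)
    rw [e_apply D γ.2] at this
    refine this.trans ?_
    gcongr
    linarith
  have hyf : ∀ k, δ ≤ f (y k) := fun k => by
    change δ ≤ f (_ • _)
    rw [map_smul, smul_eq_mul, map_sum, le_inv_mul_iff₀ (hcard k), ← nsmul_eq_mul]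
    exact Finset.card_nsmul_le_sum _ _ _ fun l hl => (hA _ l hl).2
  exact absurd (ge_of_tendsto' (weaklyNull_of_isRIS hris f) hyf) (not_le.mpr hδ)

end AHSum

namespace AHSum

/-! ### Shrinking decompositions and surjectivity criteria in general normed spaces -/

section dualNorm

variable {W : Type u} [NormedAddCommGroup W] [NormedSpace ℝ W]

theorem apply_le_of_norm_le (f : StrongDual ℝ W) {z : W} {C : ℝ} (hz : ‖z‖ ≤ C) :
    f z ≤ C * ‖f‖ := by
  refine (le_abs_self _).trans ((f.le_opNorm z).trans ?_)
  rw [mul_comm]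
  exact mul_le_mul_of_nonneg_right hz (norm_nonneg _)

theorem isShrinking_of_forall {V : ℕ → Submodule ℝ W}
    (h : ∀ (f : StrongDual ℝ W) (ε : ℝ), 0 < ε → ¬ ∀ N, ∃ n ≥ N,
      ∃ z ∈ (⨆ k, V (n + k)).topologicalClosure, ‖z‖ < 1 ∧ ε < |f z|) : IsShrinking V := by
  intro f
  rw [Metric.tendsto_atTop]
  intro ε hε
  by_contra! hcon
  refine h f (ε / 2) (by positivity) fun N => ?_
  obtain ⟨n, hn, hε'⟩ := hcon N
  rw [Real.dist_0_eq_abs,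
    abs_of_nonneg (norm_nonneg (f ∘L (⨆ k, V (n + k)).topologicalClosure.subtypeL))] at hε'
  obtain ⟨⟨z, hz⟩, hz1, hzε⟩ :=
    ContinuousLinearMap.exists_lt_apply_of_lt_opNorm _ ((half_lt_self hε).trans_le hε')
  exact ⟨n, hn, z, hz, hz1, hzε⟩

theorem IsShrinking.tendsto_comp {V : ℕ → Submodule ℝ W} (hV : IsShrinking V)
    {P : ℕ → W →L[ℝ] W} {C : ℝ} (hC : 0 ≤ C) (hP : ∀ n z, ‖z - P n z‖ ≤ C * ‖z‖)
    (hPV : ∀ n z, z - P n z ∈ (⨆ k, V (n + k)).topologicalClosure) (f : StrongDual ℝ W) :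
    Tendsto (fun n => f ∘L P n) atTop (𝓝 f) := by
  rw [tendsto_iff_norm_sub_tendsto_zero]
  have h := (hV f).const_mul C
  rw [mul_zero] at h
  refine squeeze_zero (fun n => norm_nonneg _) (fun n => ?_) h
  refine ContinuousLinearMap.opNorm_le_bound _ (by positivity) fun z => ?_
  have h1 := (f ∘L (⨆ k, V (n + k)).topologicalClosure.subtypeL).le_opNorm ⟨_, hPV n z⟩
  have h2 : ‖(f ∘L P n - f) z‖ = ‖f (z - P n z)‖ := by
    rw [map_sub, norm_sub_rev]
    rfl
  rw [h2]
  refine h1.trans ((mul_le_mul_of_nonneg_left (hP n z) (norm_nonneg _)).trans (le_of_eq ?_))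
  ring

/-- An operator bounded below on a complete space is injective with closed range. As f is the norm
limit of the elements f∘P_n of the range, the range is everything. -/
theorem exists_equiv_of_antilipschitz {E : Type u} [NormedAddCommGroup E] [NormedSpace ℝ E]
    [CompleteSpace E] (Ψ : E →L[ℝ] StrongDual ℝ W) {K : NNReal} (hΨ : ∀ φ, ‖φ‖ ≤ K * ‖Ψ φ‖)
    {P : ℕ → W →L[ℝ] W} (hlim : ∀ f : StrongDual ℝ W, Tendsto (fun n => f ∘L P n) atTop (𝓝 f))
    (hmem : ∀ (f : StrongDual ℝ W) n, f ∘L P n ∈ LinearMap.range Ψ.toLinearMap) :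
    ∃ e : StrongDual ℝ W ≃L[ℝ] E, ∀ f, Ψ (e f) = f := by
  have hanti : AntilipschitzWith K Ψ := AddMonoidHomClass.antilipschitz_of_bound Ψ hΨ
  have hclosed := hanti.isClosed_range Ψ.uniformContinuous
  have hker : LinearMap.ker Ψ.toLinearMap = ⊥ := LinearMap.ker_eq_bot.mpr hanti.injective
  have hrange : LinearMap.range Ψ.toLinearMap = ⊤ := eq_top_iff.mpr fun f _ =>
    hclosed.mem_of_tendsto (hlim f) (Eventually.of_forall fun n => hmem f n)
  exact ⟨(ContinuousLinearEquiv.ofBijective Ψ hker hrange).symm,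
    (ContinuousLinearEquiv.ofBijective Ψ hker hrange).apply_symm_apply⟩

end dualNorm

variable {X : ℕ → Type u} [∀ k, NormedAddCommGroup (X k)] [∀ k, NormedSpace ℝ (X k)]

/-! ### The Schauder decomposition and its shrinking property -/

section decomposition

variable (D : Parameters X)

theorem isClosed_component (n : ℕ) : IsClosed (D.component n : Set D.Z) := by
  have : (D.component n : Set D.Z) = {z | D.P (n + 1) z = z} ∩ {z | D.P n z = 0} := by
    ext z
    constructor
    · intro h
      have h1 := P_of_mem_component D h (n + 1)
      have h2 := P_of_mem_component D h n
      rw [if_pos (Nat.lt_succ_self n)] at h1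
      rw [if_neg (lt_irrefl n)] at h2
      exact ⟨h1, h2⟩
    · rintro ⟨h1, h2⟩
      have := sub_P_mem_component D n z
      rwa [h1, h2, sub_zero] at this
  rw [this]
  exact (isClosed_eq (D.P (n + 1)).continuous continuous_id).inter
    (isClosed_eq (D.P n).continuous continuous_const)

theorem isSchauderDecomposition_component : IsSchauderDecomposition D.component := by
  refine ⟨isClosed_component D, fun z => ⟨fun n => D.P (n + 1) z - D.P n z,
    ⟨fun n => sub_P_mem_component D n z, ?_⟩, ?_⟩⟩
  · refine (tendsto_P D z).congr fun n => ?_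
    rw [Finset.sum_range_sub (fun n => D.P n z), P_zero, sub_zero]
  · rintro w ⟨hw, hlim⟩
    -- Applying P_{[1,n]} to any expansion of z recovers its n-th partial sum, which gives
    -- uniqueness.
    have h : ∀ n, D.P n z = ∑ k ∈ Finset.range n, w k := by
      intro n
      refine tendsto_nhds_unique ((D.P n).continuous.continuousAt.tendsto.comp hlim)
        (tendsto_const_nhds.congr' ?_)
      filter_upwards [eventually_ge_atTop n] with m hm
      rw [Function.comp_apply, map_sum, ← Finset.sum_subset (Finset.range_mono hm)]
      · refine Finset.sum_congr rfl fun k hk => ?_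
        rw [P_of_mem_component D (hw k), if_pos (Finset.mem_range.mp hk)]
      · intro k _ hk
        rw [P_of_mem_component D (hw k), if_neg fun h => hk (Finset.mem_range.mpr h)]
    funext n
    rw [h, h, Finset.sum_range_succ, add_sub_cancel_left]

/-- The closed span of a tail of the decomposition. -/
theorem mem_tail_iff (n : ℕ) (z : D.Z) :
    z ∈ (⨆ k, D.component (n + k)).topologicalClosure ↔ D.P n z = 0 := by
  constructor
  · have : (⨆ k, D.component (n + k)).topologicalClosure ≤ LinearMap.ker (D.P n).toLinearMap := by
      refine Submodule.topologicalClosure_minimal _ (iSup_le fun k w hw => ?_)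
        (isClosed_eq (D.P n).continuous continuous_const)
      have := P_of_mem_component D hw n
      rwa [if_neg (by omega)] at this
    exact fun h => this h
  · intro h
    refine mem_closure_of_tendsto (tendsto_P D z) ?_
    filter_upwards [eventually_ge_atTop n] with m hm
    have hseg : D.P m z ∈ D.segment n m :=
      mem_segment D hm (by rw [P_P_of_le D hm, h]) (P_P_of_ge D le_rfl z)
    refine (iSup₂_le fun k hk => ?_ : D.segment n m ≤ ⨆ k, D.component (n + k)) hseg
    have := (Finset.mem_Ico.mp hk).1
    exact le_iSup_of_le (k - n) (by rw [Nat.add_sub_cancel' this])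

/-- If f stays large on the tails, cutting off witnesses by P_{[1,m]} gives finitely supported
vectors of norm at most 2 arbitrarily far out. Chosen successively, they form a bounded block
sequence that is not weakly null. -/
theorem isShrinking_component : IsShrinking D.component := by
  refine isShrinking_of_forall fun f ε hε hcon => ?_
  have hblock : ∀ N, ∃ p q v, N ≤ p ∧ p < q ∧ v ∈ D.segment p q ∧ ‖v‖ ≤ 2 ∧ ε < |f v| := by
    intro N
    obtain ⟨n, hn, z, hz, hz1, hzε⟩ := hcon N
    have hz0 := (mem_tail_iff D n z).mp hz
    have hlim : Tendsto (fun m => |f (D.P m z)|) atTop (𝓝 |f z|) :=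
      (f.continuous.abs.tendsto z).comp (tendsto_P D z)
    obtain ⟨m, hm1, hm2⟩ :=
      ((hlim.eventually (lt_mem_nhds hzε)).and (eventually_gt_atTop n)).exists
    exact ⟨n, m, D.P m z, hn, hm2,
      mem_segment D hm2.le (by rw [P_P_of_le D hm2.le, hz0]) (P_P_of_ge D le_rfl z),
      by linarith [norm_P_le D m z], hm1⟩
  choose p q v hNp hpq hseg hnorm hf using hblock
  let b : ℕ → ℕ := fun k => Nat.rec 0 (fun _ c => q c) k
  have hb : D.IsBlock fun k => v (b k) :=
    ⟨fun k => p (b k), fun k => q (b k), fun k => ⟨hpq _, hNp (b (k + 1)), hseg _⟩⟩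
  have hlim := (weaklyNull_of_isBlock hb ⟨2, fun k => hnorm _⟩ f).abs
  rw [abs_zero] at hlim
  have := ge_of_tendsto' hlim fun k => (hf (b k)).le
  linarith

theorem tendsto_comp_P (f : StrongDual ℝ D.Z) :
    Tendsto (fun n => f ∘L D.P n) atTop (𝓝 f) :=
  (isShrinking_component D).tendsto_comp (by norm_num : (0 : ℝ) ≤ 3) (norm_sub_P_le D)
    (fun n z => by rw [mem_tail_iff, map_sub, P_P_of_le D le_rfl, sub_self]) f

end decomposition

/-! ### The dual of 𝒵 as an ℓ₁-sum -/

section dual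

variable (D : Parameters X)

/-- The summand `(X_k* ⊕ ℓ₁(Δ_k))₁` of the space `DualSum`. -/
abbrev Parameters.DualE (k : ℕ) : Type u :=
  WithLp 1 (StrongDual ℝ (X k) × PiLp 1 (fun _ : D.Δ k => ℝ))

variable {D} in
/-- The action of an element of `(X_k* ⊕ ℓ₁(Δ_k))₁` on `E k`. -/
noncomputable def act {k : ℕ} (η : D.DualE k) (x : D.E k) : ℝ :=
  η.fst x.1 + ∑ γ : D.Δ k, η.snd γ * x.2 γ

variable {D} {k : ℕ}

theorem act_add_left (η η' : D.DualE k) (x : D.E k) : act (η + η') x = act η x + act η' x := by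
  simp only [act, WithLp.add_fst, WithLp.add_snd, add_apply, PiLp.add_apply,
    add_mul, Finset.sum_add_distrib]
  ring

theorem act_smul_left (a : ℝ) (η : D.DualE k) (x : D.E k) : act (a • η) x = a * act η x := by
  change (a • η.fst) x.1 + ∑ γ : D.Δ k, a * η.snd γ * x.2 γ = _
  simp only [act, mul_add, Finset.mul_sum, mul_assoc]
  rfl

theorem act_add_right (η : D.DualE k) (x y : D.E k) : act η (x + y) = act η x + act η y := by
  simp only [act, Prod.fst_add, Prod.snd_add, map_add, Pi.add_apply, mul_add,
    Finset.sum_add_distrib]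
  ring

theorem act_smul_right (a : ℝ) (η : D.DualE k) (x : D.E k) : act η (a • x) = a * act η x := by
  simp only [act, Prod.smul_fst, Prod.smul_snd, map_smul, Pi.smul_apply, smul_eq_mul, mul_add,
    Finset.mul_sum, mul_left_comm]

theorem act_zero_left (x : D.E k) : act (0 : D.DualE k) x = 0 := by
  rw [← zero_smul ℝ (0 : D.DualE k), act_smul_left, zero_mul]

theorem norm_dualE (η : D.DualE k) : ‖η‖ = ‖η.fst‖ + ∑ γ : D.Δ k, |η.snd γ| := by
  rw [WithLp.prod_norm_eq_of_L1, PiLp.norm_eq_of_L1]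
  rfl

theorem abs_act_le (η : D.DualE k) (x : D.E k) : |act η x| ≤ ‖η‖ * ‖x‖ := by
  rw [norm_dualE, add_mul, Finset.sum_mul]
  refine (abs_add_le _ _).trans (add_le_add ?_ ?_)
  · exact (η.fst.le_opNorm _).trans (mul_le_mul_of_nonneg_left (norm_fst_le x) (norm_nonneg _))
  · refine (Finset.abs_sum_le_sum_abs _ _).trans (Finset.sum_le_sum fun γ _ => ?_)
    rw [abs_mul]
    exact mul_le_mul_of_nonneg_left (abs_snd_le D.toData k x γ) (abs_nonneg _)

theorem exists_half_norm_le_apply {V : Type*} [NormedAddCommGroup V] [NormedSpace ℝ V]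
    (f : StrongDual ℝ V) : ∃ x, ‖x‖ ≤ 1 ∧ ‖f‖ / 2 ≤ f x := by
  rcases eq_or_ne f 0 with rfl | hf
  · exact ⟨0, by simp, by simp⟩
  · obtain ⟨x, hx, hfx⟩ := f.exists_lt_apply_of_lt_opNorm (half_lt_self (norm_pos_iff.mpr hf))
    rcases le_total 0 (f x) with h | h
    · exact ⟨x, hx.le, by rw [Real.norm_of_nonneg h] at hfx; exact hfx.le⟩
    · refine ⟨-x, by rw [norm_neg]; exact hx.le, ?_⟩
      rw [Real.norm_of_nonpos h] at hfx
      rw [map_neg]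
      exact hfx.le

theorem exists_half_norm_le_act (η : D.DualE k) :
    ∃ x : D.E k, ‖x‖ ≤ 1 ∧ ‖η‖ / 2 ≤ act η x := by
  obtain ⟨x, hx, hηx⟩ := exists_half_norm_le_apply η.fst
  refine ⟨(x, fun γ => SignType.sign (η.snd γ)), ?_, ?_⟩
  · rw [Prod.norm_def]
    refine max_le hx ((pi_norm_le_iff_of_nonneg zero_le_one).mpr fun γ => ?_)
    rcases lt_trichotomy (η.snd γ) 0 with h | h | h <;> simp [h]
  · have h0 : 0 ≤ ∑ γ : D.Δ k, |η.snd γ| := Finset.sum_nonneg fun _ _ => abs_nonneg _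
    have : act η (x, fun γ => (SignType.sign (η.snd γ) : ℝ)) =
        η.fst x + ∑ γ : D.Δ k, |η.snd γ| := by
      rw [act]
      congr 1
      exact Finset.sum_congr rfl fun γ _ => by rw [mul_comm, sign_mul_self]
    rw [this, norm_dualE]
    linarith

/-- Every functional on `E k` is given by an element of `(X_k* ⊕ ℓ₁(Δ_k))₁`. -/
theorem exists_act_eq (g : StrongDual ℝ (D.E k)) : ∃ η : D.DualE k, ∀ x, act η x = g x := by
  classical
  refine ⟨WithLp.toLp 1 (g ∘L ContinuousLinearMap.inl ℝ _ _,
    WithLp.toLp 1 fun γ => g (0, Pi.single γ 1)), fun x => ?_⟩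
  have h2 : ((0, x.2) : D.E k) = ∑ γ : D.Δ k, x.2 γ • ((0, Pi.single γ 1) : D.E k) := by
    refine Prod.ext ?_ ?_
    · simp [Prod.fst_sum]
    · rw [Prod.snd_sum]
      funext γ
      simp [Finset.sum_apply, Pi.single_apply]
  have h1 : x = (x.1, 0) + (0, x.2) := by simp
  conv_rhs => rw [h1, map_add, h2, map_sum]
  simp only [map_smul, smul_eq_mul, mul_comm (x.2 _)]
  rfl

theorem summable_norm_dualSum (φ : D.DualSum) : Summable fun k => ‖φ k‖ := by
  have := lp.hasSum_norm (by simp) φ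
  simpa using this.summable

theorem norm_dualSum (φ : D.DualSum) : ‖φ‖ = ∑' k, ‖φ k‖ := by
  have := lp.norm_eq_tsum_rpow (by simp) φ
  simpa using this

theorem abs_act_val_le (φ : D.DualSum) (z : D.Z) (k : ℕ) :
    ‖act (φ k) (D.val k z)‖ ≤ ‖φ k‖ * ‖z‖ :=
  (abs_act_le _ _).trans (mul_le_mul_of_nonneg_left (norm_val_le D k z) (norm_nonneg _))

theorem summable_act (φ : D.DualSum) (z : D.Z) : Summable fun k => act (φ k) (D.val k z) :=
  Summable.of_norm_bounded ((summable_norm_dualSum φ).mul_right ‖z‖) (abs_act_val_le φ z)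

variable (D) in
/-- The action of `DualSum` on `𝒵`. -/
noncomputable def Parameters.toDual : D.DualSum →L[ℝ] StrongDual ℝ D.Z :=
  LinearMap.mkContinuous₂
    (LinearMap.mk₂ ℝ (fun (φ : D.DualSum) (z : D.Z) => ∑' k, act (φ k) (D.val k z))
      (fun φ ψ z => by
        rw [← (summable_act φ z).tsum_add (summable_act ψ z)]
        exact tsum_congr fun k => act_add_left _ _ _)
      (fun a φ z => by
        rw [smul_eq_mul, ← tsum_mul_left]
        exact tsum_congr fun k => act_smul_left _ _ _)
      (fun φ z w => by
        rw [← (summable_act φ z).tsum_add (summable_act φ w)]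
        exact tsum_congr fun k => by rw [map_add, act_add_right])
      (fun a φ z => by
        rw [smul_eq_mul, ← tsum_mul_left]
        exact tsum_congr fun k => by rw [map_smul, act_smul_right]))
    1 fun φ z => by
      rw [one_mul, norm_dualSum, ← tsum_mul_right]
      exact tsum_of_norm_bounded ((summable_norm_dualSum φ).mul_right ‖z‖).hasSum
        (abs_act_val_le φ z)

theorem toDual_apply (φ : D.DualSum) (z : D.Z) :
    D.toDual φ z = ∑' k, act (φ k) (D.val k z) :=
  rfl

/-- Test φ on i_n(x_0, …, x_{n-1}), where x_k attains half the norm of φ_k. The vector has norm at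
most 2, and its uncontrolled coordinates from n on meet only the tail of φ, which tends to zero. In
the limit ‖φ‖/2 ≤ 2‖Ψφ‖, with Ψ = `D.toDual`. -/
theorem norm_le_norm_toDual (φ : D.DualSum) : ‖φ‖ ≤ 4 * ‖D.toDual φ‖ := by
  have hsum := summable_norm_dualSum φ
  choose x hx hφx using fun k => exists_half_norm_le_act (φ k)
  have key : ∀ n, (∑ k ∈ Finset.range n, ‖φ k‖) / 2 - 2 * ∑' k, ‖φ (k + n)‖ ≤
      2 * ‖D.toDual φ‖ := by
    intro n
    let u : ∀ k : Fin n, D.E k := fun k => x k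
    let z : D.Z := ⟨D.i n u, D.i_mem n u⟩
    have hu : ‖u‖ ≤ 1 := (pi_norm_le_iff_of_nonneg zero_le_one).mpr fun k => hx k
    have hz : ‖z‖ ≤ 2 := (norm_i_le D n u).trans (by linarith)
    have h1 : (∑ k ∈ Finset.range n, ‖φ k‖) / 2 ≤
        ∑ k ∈ Finset.range n, act (φ k) (D.val k z) := by
      rw [Finset.sum_div]
      refine Finset.sum_le_sum fun k hk => ?_
      have hk := Finset.mem_range.mp hk
      have : D.val k z = x k := by
        rw [val_i, ext_of_lt D.toData (Nat.lt_succ_self k) hk, Parameters.extendZero,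
          LinearMap.pi_apply, dif_pos hk]
        rfl
      rw [this]
      exact hφx k
    have h2 : |∑' k, act (φ (k + n)) (D.val (k + n) z)| ≤ 2 * ∑' k, ‖φ (k + n)‖ := by
      rw [← tsum_mul_left]
      refine tsum_of_norm_bounded (((summable_nat_add_iff n).mpr hsum).mul_left 2).hasSum
        fun k => (abs_act_val_le φ z _).trans ?_
      rw [mul_comm]
      exact mul_le_mul_of_nonneg_right hz (norm_nonneg _)
    have h3 := (summable_act φ z).sum_add_tsum_nat_add n
    rw [← toDual_apply] at h3
    have h4 : D.toDual φ z ≤ 2 * ‖D.toDual φ‖ := apply_le_of_norm_le _ hz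
    linarith [neg_le_of_abs_le h2]
  have hlim := (hsum.hasSum.tendsto_sum_nat.div_const 2).sub
    ((tendsto_sum_nat_add fun k => ‖φ k‖).const_mul 2)
  rw [← norm_dualSum, mul_zero, sub_zero] at hlim
  linarith [le_of_tendsto' hlim key]

theorem comp_val_mem_range (g : StrongDual ℝ (D.E k)) (f : StrongDual ℝ D.Z)
    (h : ∀ z, f z = g (D.val k z)) : f ∈ LinearMap.range D.toDual.toLinearMap := by
  obtain ⟨η, hη⟩ := exists_act_eq g
  refine ⟨lp.single 1 k η, ContinuousLinearMap.ext fun z => ?_⟩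
  change D.toDual _ z = f z
  rw [toDual_apply, tsum_eq_single k, lp.single_apply_self, hη, h]
  intro l hl
  rw [lp.single_apply_ne _ _ _ hl, act_zero_left]

/-- Since P_{[1,n]} factors through the first n coordinates, f∘P_{[1,n]} is a finite sum of
functionals each depending on one coordinate in E k. -/
theorem comp_P_mem_range (f : StrongDual ℝ D.Z) (n : ℕ) :
    f ∘L D.P n ∈ LinearMap.range D.toDual.toLinearMap := by
  let j : (∀ k : Fin n, D.E k) →L[ℝ] D.Z := (D.i n).codRestrict D.Z (D.i_mem n)
  let g : ∀ k : Fin n, StrongDual ℝ (D.E k) := fun k => f ∘L j ∘L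
    ContinuousLinearMap.single ℝ (fun k : Fin n => D.E k) k
  let c : ∀ k : Fin n, D.Z →L[ℝ] D.E k := fun k =>
    ContinuousLinearMap.proj k ∘L D.R n ∘L D.Z.subtypeL
  have : f ∘L D.P n = ∑ k, g k ∘L c k := by
    ext z
    rw [sum_apply]
    change f (j (D.R n z)) = ∑ k, f (j (Pi.single k (D.R n z k)))
    rw [← map_sum, ← map_sum, Finset.univ_sum_single]
  rw [this]
  exact Submodule.sum_mem _ fun k _ => comp_val_mem_range (g k) _ fun z => rfl

theorem exists_dual_equiv (D : Parameters X) : ∃ Φ : StrongDual ℝ D.Z ≃L[ℝ] D.DualSum,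
    ∀ (f : StrongDual ℝ D.Z) (z : D.Z), HasSum (fun k => act (Φ f k) (D.val k z)) (f z) := by
  obtain ⟨Φ, hΦ⟩ := exists_equiv_of_antilipschitz D.toDual (K := 4) norm_le_norm_toDual
    (tendsto_comp_P D) comp_P_mem_range
  refine ⟨Φ, fun f z => ?_⟩
  have := (summable_act (Φ f) z).hasSum
  rwa [← toDual_apply, hΦ] at this

end dual

end AHSum

theorem mainTheorem5 {X : ℕ → Type u} [∀ k, NormedAddCommGroup (X k)] [∀ k, NormedSpace ℝ (X k)]
    [∀ k, CompleteSpace (X k)] [∀ k, TopologicalSpace.SeparableSpace (X k)]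
    (D : AHSum.Parameters X) :
    (∀ z : ℕ → D.Z, D.IsRIS z → AHSum.WeaklyNull z) ∧
    (∀ z : ℕ → D.Z, D.IsBlock z → (∃ C : ℝ, ∀ k, ‖z k‖ ≤ C) → AHSum.WeaklyNull z) ∧
    AHSum.IsSchauderDecomposition D.component ∧
    AHSum.IsShrinking D.component ∧
    ∃ Φ : StrongDual ℝ D.Z ≃L[ℝ] D.DualSum, ∀ (f : StrongDual ℝ D.Z) (z : D.Z),
      HasSum (fun k => (Φ f k).fst ((z : D.Ambient) k).1 +
        ∑ γ : D.Δ k, (Φ f k).snd γ * ((z : D.Ambient) k).2 γ) (f z) :=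
  ⟨fun _ h => AHSum.weaklyNull_of_isRIS h, fun _ h hb => AHSum.weaklyNull_of_isBlock h hb,
    AHSum.isSchauderDecomposition_component D, AHSum.isShrinking_component D,
    AHSum.exists_dual_equiv D⟩
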